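/- Let $K$ be a number field of degree $n$ with ring of integers $\mathcal O_K$ and $r(K)$ roots of unity, and let $t\ge 2$ be an integer. Let $E=K\otimes_{\mathbb Q}\mathbb R\cong\mathbb R^{r_1}\times\mathbb C^{r_2}$, where $(r_1,r_2)$ is the signature of $K$, and let $\mathcal O_K$ act on $E$, and componentwise on $E^t$, by multiplication through the canonical embedding. Equip $E^t$ (a real vector space of dimension $tn$) with the Euclidean norm induced by the trace form, $\|x\|^2=\sum_{j=1}^t \operatorname{tr}(x_j\overline{x_j})$, where $\operatorname{tr}(x\overline{x})=\sum_{v\text{ real}}|x_v|^2+2\sum_{v\text{ complex}}|x_v|^2$; for $x\in K$ this is the sum of $|\sigma(x)|^2$ over the $n$ embeddings $\sigma:K\to\mathbb C$. An $\mathcal O_K$-lattice of dimension $t$ is a free $\mathcal O_K$-submodule $\Lambda$ of rank $t$ of $E^t$ that is discrete and spans $E^t$ over $\mathbb R$. Its first minimum $\lambda_1$ is the least norm of a nonzero vector of $\Lambda$, and its packing density is $\Delta(\Lambda)=\operatorname{vol}(\mathcal B_{\lambda_1/2})/\operatorname{vol}(E^t/\Lambda)$, where $\mathcal B_\rho=\{x\in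 E^t:\|x\|\le\rho\}$. Then for every $\varepsilon>0$ there is an $\mathcal O_K$-lattice $\Lambda$ of dimension $t$ such that $$\Delta(\Lambda)\ \ge\ \frac{r(K)\,t\,\zeta(tn)\,(1-\varepsilon)}{e\,(1-e^{-t})\,2^{tn}},$$ where $\zeta$ is the Riemann zeta function. -/

import Mathlib

open NumberField NumberField.mixedEmbedding MeasureTheory

noncomputable section

namespace OKLattice

variable (K : Type*) [Field K]

/-- The real algebra `E = K ⊗ ℝ` is `mixedSpace K = ℝ ^ r₁ × ℂ ^ r₂`; the ring of integers acts on
it by multiplication through the canonical embedding. -/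
instance instModule : Module (𝓞 K) (mixedSpace K) :=
  Module.compHom (mixedSpace K) ((mixedEmbedding K).comp (algebraMap (𝓞 K) K))

theorem smul_def (a : 𝓞 K) (x : mixedSpace K) : a • x = mixedEmbedding K (a : K) * x := rfl

variable {K} [NumberField K]

/-- The value at `x` of the trace form of `E`, `tr (x * conj x)`: the square of the absolute value
at each real place plus twice the square of the absolute value at each complex place. -/
def traceForm (x : mixedSpace K) : ℝ :=
  ∑ w : InfinitePlace K, (w.mult : ℝ) * normAtPlace w x ^ 2

/-- On `K`, the trace form is the sum of `|σ a| ^ 2` over all `n` embeddings `σ` of `K` in `ℂ`. -/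
theorem traceForm_mixedEmbedding (a : K) :
    traceForm (mixedEmbedding K a) = ∑ φ : K →+* ℂ, ‖φ a‖ ^ 2 := by
  classical
  rw [← Finset.sum_fiberwise Finset.univ InfinitePlace.mk (fun φ : K →+* ℂ => ‖φ a‖ ^ 2)]
  refine Finset.sum_congr rfl fun w _ => ?_
  rw [normAtPlace_apply, ← InfinitePlace.card_filter_mk_eq w, ← nsmul_eq_mul,
    ← Finset.sum_const]
  refine Finset.sum_congr rfl fun φ hφ => ?_
  rw [← (Finset.mem_filter.mp hφ).2, InfinitePlace.apply]

/-- The trace form is the trace of `x * conj x` from the real algebra `E` to `ℝ`. -/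
theorem traceForm_eq_trace (x : mixedSpace K) :
    traceForm x = Algebra.trace ℝ (mixedSpace K) (x * star x) := by
  classical
  have key : Algebra.trace ℝ (mixedSpace K) (x * star x) =
      ∑ i, (stdBasis K).repr (x * star x * stdBasis K i) i := by
    rw [Algebra.trace_eq_matrix_trace (stdBasis K), Matrix.trace]
    refine Finset.sum_congr rfl fun i _ => ?_
    rw [Matrix.diag_apply, Algebra.leftMulMatrix_eq_repr_mul]
  have hreal : ∀ w : {w : InfinitePlace K // w.IsReal},
      (stdBasis K).repr (x * star x * stdBasis K (Sum.inl w)) (Sum.inl w) = x.1 w ^ 2 := by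
    intro w
    have h1 : (stdBasis K (Sum.inl w)).1 w = 1 := by
      rw [← stdBasis_apply_isReal, Module.Basis.repr_self, Finsupp.single_eq_same]
    rw [stdBasis_apply_isReal, Prod.fst_mul, Pi.mul_apply, h1]
    simp [sq]
  have hcomplex : ∀ (w : {w : InfinitePlace K // w.IsComplex}) (k : Fin 2),
      (stdBasis K).repr (x * star x * stdBasis K (Sum.inr (w, k))) (Sum.inr (w, k)) =
        ‖x.2 w‖ ^ 2 := by
    intro w k
    have h : (x * star x).2 w = ((‖x.2 w‖ ^ 2 : ℝ) : ℂ) := by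
      have := Complex.mul_conj' (x.2 w)
      simpa using this
    have hre : ((stdBasis K (Sum.inr (w, k))).2 w).re = if k = 0 then 1 else 0 := by
      rw [← stdBasis_apply_isComplex_fst, Module.Basis.repr_self, Finsupp.single_apply]
      simp
    have him : ((stdBasis K (Sum.inr (w, k))).2 w).im = if k = 1 then 1 else 0 := by
      rw [← stdBasis_apply_isComplex_snd, Module.Basis.repr_self, Finsupp.single_apply]
      simp
    obtain rfl | rfl : k = 0 ∨ k = 1 := by omega
    · rw [stdBasis_apply_isComplex_fst, Prod.snd_mul, Pi.mul_apply, h, Complex.re_ofReal_mul]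
      rw [hre]; simp
    · rw [stdBasis_apply_isComplex_snd, Prod.snd_mul, Pi.mul_apply, h, Complex.im_ofReal_mul]
      rw [him]; simp
  rw [key, Fintype.sum_sum_type, Fintype.sum_prod_type]
  simp only [hreal, hcomplex, Finset.sum_const, Finset.card_univ, Fintype.card_fin]
  rw [traceForm, ← Fintype.sum_subtype_add_sum_subtype (fun w : InfinitePlace K => w.IsReal)]
  congr 1
  · refine Finset.sum_congr rfl fun w _ => ?_
    rw [normAtPlace_apply_of_isReal w.2, InfinitePlace.mult, if_pos w.2]
    simp
  · refine Fintype.sum_equiv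
      (Equiv.subtypeEquivRight fun w => InfinitePlace.not_isReal_iff_isComplex) _ _ fun w => ?_
    have hw : InfinitePlace.IsComplex w.1 := InfinitePlace.not_isReal_iff_isComplex.mp w.2
    rw [normAtPlace_apply_of_isComplex hw, InfinitePlace.mult, if_neg w.2]
    simp only [Nat.cast_ofNat, nsmul_eq_mul]
    rfl

variable {t : ℕ}

/-- The Euclidean norm on `E ^ t` that is induced by the trace form. -/
def euclNorm (x : Fin t → mixedSpace K) : ℝ :=
  Real.sqrt (∑ j, traceForm (x j))

/-- The `𝓞 K`-submodule `Λ` of `E ^ t` is an `𝓞 K`-lattice of dimension `t`: it is free of rank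
`t` over `𝓞 K`, and it is a (full) lattice of the real space `E ^ t`, that is, discrete and
spanning. -/
structure IsLattice (Λ : Submodule (𝓞 K) (Fin t → mixedSpace K)) : Prop where
  free : Module.Free (𝓞 K) Λ
  finrank_eq : Module.finrank (𝓞 K) Λ = t
  discrete : DiscreteTopology Λ
  span_eq_top : Submodule.span ℝ (Λ : Set (Fin t → mixedSpace K)) = ⊤

/-- The first minimum: the least Euclidean norm of a nonzero lattice vector. -/
def firstMin (Λ : Submodule (𝓞 K) (Fin t → mixedSpace K)) : ℝ :=
  sInf (euclNorm '' {x | x ∈ Λ ∧ x ≠ 0})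

open scoped Classical in
/-- The packing density: the volume of the Euclidean ball of radius half the first minimum, divided
by the volume of the quotient by the lattice. Both volumes are taken with respect to the same
Haar measure of `E ^ t` (Lebesgue measure in the coordinates of `ℝ ^ r₁ × ℂ ^ r₂`); their quotient does not depend on its normalization. -/
def packingDensity (Λ : Submodule (𝓞 K) (Fin t → mixedSpace K)) : ℝ :=
  (volume {x : Fin t → mixedSpace K | euclNorm x ≤ firstMin Λ / 2}).toReal /
    ZLattice.covolume (Λ.restrictScalars ℤ) volume

end OKLattice

end

/-!
The proof combines a mean value theorem of Siegel type, over a family of free `𝓞 K`-lattices in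
`E ^ t` of fixed covolume, with Rogers' way of making the successive minima of a lattice equal.
Write `n = [K : ℚ]`, `N = t n` and `t = s + 1`.

*Averaging.* For `α ∈ E ^ s` and a natural number `q`, take the image of `(𝓞 K) ^ t` under the
unimodular `E`-linear map `(x₀, x') ↦ (q⁻¹ x₀, q ^ (1 / s) (x' + x₀ α))` (`shear`). When `α` runs
through a fundamental domain of `(𝓞 K) ^ s`, a nonzero `x₀ ∈ 𝓞 K` induces a surjective endomorphism
`α ↦ x₀ α` of the torus `E ^ s / (𝓞 K) ^ s`, and this preserves Haar measure. Hence the mean value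
over `α` of the lattice sum of a function `f` with bounded support is *exactly* a sum over
`x₀ ≠ 0` of integrals over `E ^ s`, once `q` is so large that the lattice vectors with `x₀ = 0` lie
outside the support (`lintegral_tsum_shear`). What remains is a Riemann sum of mesh `1 / q`,
which tends to the integral of `f` divided by the covolume of `(𝓞 K) ^ t`
(`tendsto_lintegral_floor`). Removing the vectors divisible by one of finitely many primes, one
prime at a time, multiplies the limit by the corresponding Euler factors of `1 / ζ(N)`
(`tendsto_mean`).

*Choice of `f`.* The function `f` is `1 / t - n log (‖x‖ / R)`, truncated to `[0, 1]` (`radial`).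
Its integral is `vol (B_R) e (1 - e ^ (-t)) / t` (`lintegral_radial`). If the number of roots of
unity times `t ζ(N) / (e (1 - e ^ (-t)))` exceeds `vol (B_R)` over the covolume, then some lattice
of the family has a sum of `f` over its sieved vectors that is less than `r(K)`. Vectors
`v₁, …, v_t` that realize the successive minima `λ₁ ≤ ⋯ ≤ λ_t` over `K` are primitive, and so are
their `r(K)` multiples by roots of unity. Therefore `∑ f(v_k) < 1`
(`torsionOrder_mul_sum_le`), and as the logarithm in `f` turns this sum into a product,
`R ^ t ≤ λ₁ ⋯ λ_t`.

*Equalizing the minima.* At each infinite place, Gram–Schmidt orthonormalization gives an isometry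
`U` of `E ^ t`, linear over `E`, for which the vectors `U v_k` are triangular
(`exists_isometry_triangular`). Dividing the `k`-th coordinate by `λ_k` after `U` makes all nonzero
lattice vectors have norm at least `1`, and divides the covolume by `(λ₁ ⋯ λ_t) ^ n ≥ R ^ N`
(`exists_isLattice_packingDensity_ge`).
-/

noncomputable section

open scoped ENNReal NNReal Topology Pointwise Classical
open Filter

namespace OKLattice

/-! ### Lattice sums and integrals -/

section Averaging

variable {V : Type*} [AddCommGroup V] [MeasurableSpace V] [MeasurableAdd₂ V] {μ : Measure V}
  [μ.IsAddLeftInvariant] {L : AddSubgroup V} [Countable L] {D : Set V}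

/-- Unfolding: the integral over a fundamental domain of the sum over the lattice is the integral
over the whole space. -/
theorem setLIntegral_tsum_add (hD : IsAddFundamentalDomain L D μ) {h : V → ℝ≥0∞}
    (hh : Measurable h) (c : V) :
    ∫⁻ v in D, ∑' y : L, h ((y : V) + c + v) ∂μ = ∫⁻ x, h x ∂μ := by
  have : VAddInvariantMeasure L V μ := ⟨fun c s hs => measure_preimage_add μ (c : V) s⟩
  rw [lintegral_tsum fun y => by fun_prop, ← lintegral_add_left_eq_self h c,
    hD.lintegral_eq_tsum'']
  refine tsum_congr fun y => lintegral_congr fun v => congr_arg h ?_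
  rw [AddSubgroup.vadd_def, vadd_eq_add]
  abel

/-- Unfolding along a surjective endomorphism `m` that maps the lattice to itself; it says that the
endomorphism of the torus `V / L` induced by `m` preserves Haar measure. As a functional of `h` the
left-hand side is invariant under translations by `m w`, that is, by all vectors of `V`; averaging
it over the translations in `D` and exchanging the two integrals gives the right-hand side. -/
theorem setLIntegral_tsum_add_map [SFinite μ] (hD : IsAddFundamentalDomain L D μ) (hD0 : μ D ≠ 0)
    (hDtop : μ D ≠ ∞) (m : V →+ V) (hm : Measurable m) (hsurj : Function.Surjective m)
    (hmL : ∀ l ∈ L, m l ∈ L) {h : V → ℝ≥0∞} (hh : Measurable h) :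
    ∫⁻ α in D, ∑' y : L, h ((y : V) + m α) ∂μ = ∫⁻ x, h x ∂μ := by
  have : VAddInvariantMeasure L V μ := ⟨fun c s hs => measure_preimage_add μ (c : V) s⟩
  have hinv : ∀ v : V, ∫⁻ α in D, ∑' y : L, h ((y : V) + m α + v) ∂μ =
      ∫⁻ α in D, ∑' y : L, h ((y : V) + m α) ∂μ := by
    intro v
    obtain ⟨w, rfl⟩ := hsurj v
    have hper : ∀ (l : L) (x : V), ∑' y : L, h ((y : V) + m (l +ᵥ x)) =
        ∑' y : L, h ((y : V) + m x) := by
      intro l x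
      rw [← (Equiv.addRight (⟨m l, hmL l l.2⟩ : L)).tsum_eq fun y : L => h ((y : V) + m x)]
      refine tsum_congr fun y => congr_arg h ?_
      simp [AddSubgroup.vadd_def, add_assoc]
    rw [hD.setLIntegral_eq (hD.vadd_of_comm w) (fun x => ∑' y : L, h ((y : V) + m x)) hper,
      show (w +ᵥ D : Set V) = (fun x => w + x) '' D from rfl,
      ← (measurePreserving_add_left μ w).setLIntegral_comp_emb (measurableEmbedding_addLeft w)]
    refine lintegral_congr fun α => tsum_congr fun y => congr_arg h ?_
    rw [map_add]
    abel
  refine (ENNReal.mul_left_inj hD0 hDtop).1 ?_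
  calc (∫⁻ α in D, ∑' y : L, h ((y : V) + m α) ∂μ) * μ D
      = ∫⁻ v in D, ∫⁻ α in D, ∑' y : L, h ((y : V) + m α + v) ∂μ ∂μ := by
        simp_rw [hinv]; rw [setLIntegral_const]
    _ = ∫⁻ α in D, ∫⁻ v in D, ∑' y : L, h ((y : V) + m α + v) ∂μ ∂μ := by
        refine lintegral_lintegral_swap (Measurable.aemeasurable ?_)
        refine Measurable.tsum fun y => ?_
        fun_prop
    _ = (∫⁻ x, h x ∂μ) * μ D := by
        simp_rw [setLIntegral_tsum_add hD hh]; rw [setLIntegral_const]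

end Averaging

theorem lintegral_comp_smul {V : Type*} [NormedAddCommGroup V] [NormedSpace ℝ V]
    [FiniteDimensional ℝ V] [MeasurableSpace V] [BorelSpace V] (μ : Measure V)
    [μ.IsAddHaarMeasure] {c : ℝ} (hc : 0 < c) (h : V → ℝ≥0∞) :
    ENNReal.ofReal (c ^ Module.finrank ℝ V) * ∫⁻ x, h (c • x) ∂μ = ∫⁻ x, h x ∂μ := by
  have h1 : ∫⁻ x, h (c • x) ∂μ = ∫⁻ x, h x ∂(Measure.map (c • ·) μ) :=
    (lintegral_map_equiv h (MeasurableEquiv.smul₀ c hc.ne')).symm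
  rw [h1, Measure.map_addHaar_smul μ hc.ne', lintegral_smul_measure, smul_eq_mul, ← mul_assoc,
    ← ENNReal.ofReal_mul (by positivity), abs_of_pos (by positivity),
    mul_inv_cancel₀ (by positivity), ENNReal.ofReal_one, one_mul]

section Floor

variable {V ι : Type*} [NormedAddCommGroup V] [NormedSpace ℝ V] [FiniteDimensional ℝ V]
  [MeasurableSpace V] [BorelSpace V] [Fintype ι] (b : Module.Basis ι ℝ V)

theorem measurable_floor : Measurable fun x : V => (ZSpan.floor b x : V) := by
  have : (fun x : V => (ZSpan.floor b x : V)) = fun x => ∑ i, (⌊b.repr x i⌋ : ℝ) • b i := by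
    funext x
    simp [ZSpan.floor, Int.cast_smul_eq_zsmul]
  rw [this]
  refine Finset.measurable_sum _ fun i _ => Measurable.smul_const ?_ _
  have h1 : Measurable fun x : V => b.repr x i :=
    (b.coord i).continuous_of_finiteDimensional.measurable
  exact (measurable_from_top (f := fun z : ℤ => (z : ℝ))).comp (Int.measurable_floor.comp h1)

/-- A sum over a lattice, times the covolume, is the integral of a step function. -/
theorem tsum_mul_measure_fundamentalDomain (μ : Measure V) [μ.IsAddHaarMeasure] (h : V → ℝ≥0∞) :
    (∑' y : Submodule.span ℤ (Set.range b), h y) * μ (ZSpan.fundamentalDomain b) =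
      ∫⁻ x, h (ZSpan.floor b x) ∂μ := by
  have hD := ZSpan.isAddFundamentalDomain b μ
  have : VAddInvariantMeasure (Submodule.span ℤ (Set.range b)) V μ :=
    ⟨fun c s hs => measure_preimage_add μ (c : V) s⟩
  have : MeasurableConstVAdd (Submodule.span ℤ (Set.range b)) V :=
    ⟨fun c => measurable_const_add (c : V)⟩
  rw [hD.lintegral_eq_tsum'', ← ENNReal.tsum_mul_right]
  refine tsum_congr fun y => ?_
  rw [← setLIntegral_const]
  refine setLIntegral_congr_fun (ZSpan.fundamentalDomain_measurableSet b) fun x hx => ?_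
  have h1 := ZSpan.fract_eq_self.2 hx
  have h2 := ZSpan.fract_zSpan_add b x y.2
  rw [h1, ZSpan.fract_apply] at h2
  have : (ZSpan.floor b (y +ᵥ x) : V) = y := by
    rw [Submodule.vadd_def, vadd_eq_add]
    exact (add_right_cancel ((sub_eq_iff_eq_add.1 h2).trans (add_comm _ _))).symm
  simp only [this]

end Floor

/-! ### The standard lattice and the shears -/

section

variable {K : Type*} [Field K]

theorem intSmul_mul (a : 𝓞 K) (x y : mixedSpace K) : a • (x * y) = (a • x) * y := by
  rw [smul_def, smul_def, mul_assoc]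

instance : IsScalarTower (𝓞 K) (mixedSpace K) (mixedSpace K) :=
  ⟨fun a x y => (intSmul_mul a x y).symm⟩

variable (K) in
/-- The canonical embedding of `(𝓞 K) ^ t` in `E ^ t`; its range is the standard `𝓞 K`-lattice. -/
def intEmb (t : ℕ) : (Fin t → 𝓞 K) →ₗ[𝓞 K] (Fin t → mixedSpace K) where
  toFun y j := mixedEmbedding K (y j : K)
  map_add' x y := by
    funext j
    simp
  map_smul' a x := by
    funext j
    simp [smul_def]

@[simp] theorem intEmb_apply {t : ℕ} (y : Fin t → 𝓞 K) (j : Fin t) :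
    intEmb K t y j = mixedEmbedding K (y j : K) := rfl

/-- The `E`-linear map `(x₀, x') ↦ (η x₀, ε (x' + x₀ α))` of `E × E ^ s = E ^ (s + 1)`. The
coordinate with index `0` plays the role of `x₀`. -/
def shear {s : ℕ} (η ε : ℝ) (α : Fin s → mixedSpace K) :
    (Fin (s + 1) → mixedSpace K) →ₗ[mixedSpace K] (Fin (s + 1) → mixedSpace K) where
  toFun x := Fin.cons (η • x 0) fun j => ε • (x j.succ + x 0 * α j)
  map_add' x y := by
    funext j
    refine Fin.cases ?_ (fun j => ?_) j
    · simp
    · simp only [Fin.cons_succ, Pi.add_apply, ← smul_add]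
      congr 1
      ring
  map_smul' a x := by
    funext j
    refine Fin.cases ?_ (fun j => ?_) j
    · simp
    · simp only [Fin.cons_succ, Pi.smul_apply, RingHom.id_apply, smul_eq_mul,
        mul_smul_comm, mul_assoc, mul_add]

@[simp] theorem shear_apply_zero {s : ℕ} (η ε : ℝ) (α : Fin s → mixedSpace K)
    (x : Fin (s + 1) → mixedSpace K) : shear η ε α x 0 = η • x 0 := rfl

@[simp] theorem shear_apply_succ {s : ℕ} (η ε : ℝ) (α : Fin s → mixedSpace K)
    (x : Fin (s + 1) → mixedSpace K) (j : Fin s) :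
    shear η ε α x j.succ = ε • (x j.succ + x 0 * α j) := rfl

variable [NumberField K]

theorem intEmb_injective (t : ℕ) : Function.Injective (intEmb K t) := fun x y h => by
  funext j
  exact RingOfIntegers.coe_injective (mixedEmbedding_injective K (congr_fun h j))

variable (K) in
/-- The real basis of `E ^ t` consisting of a copy of an integral basis in each coordinate; it is a
`ℤ`-basis of the standard lattice. -/
def intBasis (t : ℕ) : Module.Basis (Σ _ : Fin t, Module.Free.ChooseBasisIndex ℤ (𝓞 K)) ℝ
    (Fin t → mixedSpace K) := Pi.basis fun _ => latticeBasis K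

theorem mem_span_intBasis {t : ℕ} {x : Fin t → mixedSpace K} :
    x ∈ Submodule.span ℤ (Set.range (intBasis K t)) ↔ ∃ y, intEmb K t y = x := by
  have h1 : x ∈ Submodule.span ℤ (Set.range (intBasis K t)) ↔
      ∀ j, x j ∈ Submodule.span ℤ (Set.range (latticeBasis K)) := by
    simp_rw [Module.Basis.mem_span_iff_repr_mem ℤ]
    rw [Sigma.forall]
    simp [intBasis, Pi.basis_repr]
  rw [h1]
  constructor
  · intro h
    have h2 : ∀ j, ∃ a : 𝓞 K, mixedEmbedding K (a : K) = x j := by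
      intro j
      obtain ⟨a, ha⟩ := (mem_span_latticeBasis K).1 (h j)
      exact ⟨a, ha⟩
    choose y hy using h2
    exact ⟨y, funext hy⟩
  · rintro ⟨y, rfl⟩ j
    exact (mem_span_latticeBasis K).2 ⟨y j, rfl⟩

variable (K) in
/-- The bijection of `(𝓞 K) ^ t` with the standard lattice, as a `ℤ`-span. -/
def intEquiv (t : ℕ) : (Fin t → 𝓞 K) ≃ Submodule.span ℤ (Set.range (intBasis K t)) :=
  Equiv.ofBijective (fun y => ⟨intEmb K t y, mem_span_intBasis.2 ⟨y, rfl⟩⟩)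
    ⟨fun x y h => intEmb_injective t (congr_arg Subtype.val h), fun x => by
      obtain ⟨y, hy⟩ := mem_span_intBasis.1 x.2
      exact ⟨y, Subtype.ext hy⟩⟩

/-- The product of the absolute values at the infinite places is the norm, a nonzero integer, so one
of these absolute values is at least `1`. -/
theorem one_le_norm_mixedEmbedding {a : 𝓞 K} (ha : a ≠ 0) :
    1 ≤ ‖mixedEmbedding K (a : K)‖ := by
  by_contra! h
  have h1 : ∀ w : InfinitePlace K, w (a : K) < 1 := fun w => by
    rw [← normAtPlace_apply]
    refine lt_of_le_of_lt ?_ h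
    rw [norm_eq_sup'_normAtPlace]
    exact Finset.le_sup' (fun w => normAtPlace w (mixedEmbedding K (a : K))) (Finset.mem_univ w)
  have h2 := InfinitePlace.prod_eq_abs_norm (a : K)
  have h3 : (1 : ℝ) ≤ |(Algebra.norm ℚ (a : K) : ℝ)| := by
    have h4 : (Algebra.norm ℚ (a : K)) = (Algebra.norm ℤ a : ℤ) := (Algebra.coe_norm_int a).symm
    rw [h4]
    have : Algebra.norm ℤ a ≠ 0 := Algebra.norm_ne_zero_iff.2 ha
    exact_mod_cast Int.one_le_abs this
  have h5 : ∏ w : InfinitePlace K, w (a : K) ^ w.mult < 1 := by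
    have h6 : ∀ w ∈ (Finset.univ : Finset (InfinitePlace K)),
        w (a : K) ^ w.mult < (fun _ => 1 : InfinitePlace K → ℝ) w := fun w _ =>
      pow_lt_one₀ (apply_nonneg w _) (h1 w) InfinitePlace.mult_pos.ne'
    simpa using Finset.prod_lt_prod_of_nonempty (fun w _ => pow_pos (InfinitePlace.pos_iff.2
      (RingOfIntegers.coe_ne_zero_iff.2 ha)) _) h6 Finset.univ_nonempty
  rw [h2] at h5
  exact absurd h5 (not_lt.2 (by exact_mod_cast h3))

theorem one_le_norm_intEmb {t : ℕ} {y : Fin t → 𝓞 K} (hy : y ≠ 0) : 1 ≤ ‖intEmb K t y‖ := by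
  obtain ⟨j, hj⟩ := Function.ne_iff.1 hy
  exact (one_le_norm_mixedEmbedding hj).trans (norm_le_pi_norm (intEmb K t y) j)

theorem volume_fundamentalDomain_intBasis (t : ℕ) :
    volume (ZSpan.fundamentalDomain (intBasis K t)) =
      volume (ZSpan.fundamentalDomain (latticeBasis K)) ^ t := by
  have : ZSpan.fundamentalDomain (intBasis K t) =
      Set.univ.pi fun _ => ZSpan.fundamentalDomain (latticeBasis K) := by
    ext x
    simp only [ZSpan.mem_fundamentalDomain, Set.mem_univ_pi]
    rw [Sigma.forall]
    simp [intBasis, Pi.basis_repr]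
  rw [this, volume_pi_pi, Finset.prod_const, Finset.card_univ, Fintype.card_fin]

instance (t : ℕ) : (volume : Measure (Fin t → mixedSpace K)).IsAddHaarMeasure :=
  have : MeasurableAdd (mixedSpace K) := inferInstance
  Measure.pi.isAddHaarMeasure fun _ => volume

/-- The topology is written here as it comes from the norm, the form that instance search meets in
`NormedSpace` lemmas. -/
instance (t : ℕ) : @BorelSpace (Fin t → mixedSpace K)
    (PseudoMetricSpace.toUniformSpace).toTopologicalSpace _ :=
  inferInstanceAs (@BorelSpace (Fin t → mixedSpace K) Pi.topologicalSpace _)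

instance : Countable (𝓞 K) :=
  (Module.Free.chooseBasis ℤ (𝓞 K)).repr.injective.countable

end

/-! ### The mean value over all nonzero vectors -/

section

variable {K : Type*} [Field K]

theorem measurable_cons (s : ℕ) : Measurable fun u : mixedSpace K × (Fin s → mixedSpace K) =>
    (Fin.cons u.1 u.2 : Fin (s + 1) → mixedSpace K) := by
  refine measurable_pi_lambda _ fun j => ?_
  refine Fin.cases ?_ (fun j => ?_) j
  · exact measurable_fst
  · exact (measurable_pi_apply j).comp measurable_snd

variable [NumberField K]

theorem finrank_pi_mixedSpace (s : ℕ) :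
    Module.finrank ℝ (Fin s → mixedSpace K) = s * Module.finrank ℚ K := by
  rw [Module.finrank_pi_fintype]
  rw [Finset.sum_const, mixedEmbedding.finrank, Finset.card_univ, Fintype.card_fin, smul_eq_mul]

/-- Multiplication by a nonzero algebraic integer preserves the standard lattice, so
`setLIntegral_tsum_add_map` applies to it. -/
theorem setLIntegral_tsum_shear {s : ℕ} {a : 𝓞 K} (ha : a ≠ 0) {g : (Fin s → mixedSpace K) → ℝ≥0∞}
    (hg : Measurable g) :
    ∫⁻ α in ZSpan.fundamentalDomain (intBasis K s), ∑' y : Fin s → 𝓞 K,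
      g (intEmb K s y + fun j => mixedEmbedding K (a : K) * α j) = ∫⁻ x, g x := by
  have hb := ZSpan.isAddFundamentalDomain' (intBasis K s) volume
  have ha' : IsUnit (mixedEmbedding K (a : K)) :=
    (IsUnit.mk0 (a : K) (RingOfIntegers.coe_ne_zero_iff.2 ha)).map _
  let m : (Fin s → mixedSpace K) →ₗ[ℝ] (Fin s → mixedSpace K) :=
    LinearMap.pi fun j => (LinearMap.mulLeft ℝ (mixedEmbedding K (a : K))) ∘ₗ LinearMap.proj j
  have hL : Countable (Submodule.span ℤ (Set.range (intBasis K s))).toAddSubgroup :=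
    (intEquiv K s).symm.injective.countable
  have key := setLIntegral_tsum_add_map hb
    (ZSpan.measure_fundamentalDomain_ne_zero (intBasis K s))
    (ZSpan.fundamentalDomain_isBounded (intBasis K s)).measure_lt_top.ne m.toAddMonoidHom
    m.continuous_of_finiteDimensional.measurable ?_ ?_ hg
  · rw [← key]
    refine lintegral_congr fun α => ?_
    exact (intEquiv K s).tsum_eq (fun y => g ((y : Fin s → mixedSpace K) + m α))
  · intro x
    refine ⟨fun j => ha'.unit⁻¹.1 * x j, funext fun j => ?_⟩
    change mixedEmbedding K (a : K) * (ha'.unit⁻¹.1 * x j) = x j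
    rw [← mul_assoc, IsUnit.mul_val_inv, one_mul]
  · intro l hl
    obtain ⟨y, rfl⟩ := mem_span_intBasis.1 hl
    exact mem_span_intBasis.2 ⟨a • y, funext fun j => by simp; rfl⟩

theorem measurable_ite_floor {s : ℕ} {f : (Fin (s + 1) → mixedSpace K) → ℝ≥0∞} (hf : Measurable f)
    (q : ℝ) : Measurable fun u : mixedSpace K × (Fin s → mixedSpace K) =>
      if (ZSpan.floor (latticeBasis K) (q • u.1) : mixedSpace K) = 0 then 0 else
        f (Fin.cons (q⁻¹ • (ZSpan.floor (latticeBasis K) (q • u.1) : mixedSpace K)) u.2) := by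
  have h1 : Measurable fun u : mixedSpace K × (Fin s → mixedSpace K) =>
      (ZSpan.floor (latticeBasis K) (q • u.1) : mixedSpace K) :=
    (measurable_floor (latticeBasis K)).comp (measurable_fst.const_smul q)
  refine Measurable.ite (h1 (measurableSet_singleton 0)) measurable_const ?_
  exact hf.comp ((measurable_cons s).comp ((h1.const_smul q⁻¹).prodMk measurable_snd))

/-- The mean value over the family of shears, as an exact integral of a step function. The condition
`B < ε` keeps the nonzero lattice vectors with first coordinate `0` out of the support of `f`. -/
theorem lintegral_tsum_shear {s : ℕ} {f : (Fin (s + 1) → mixedSpace K) → ℝ≥0∞} (hf : Measurable f)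
    {B q ε : ℝ} (hB : ∀ x, f x ≠ 0 → ‖x‖ ≤ B) (hq : 0 < q) (hε : B < ε) (hε0 : 0 < ε)
    (hεq : ε ^ s = q) :
    (∫⁻ α in ZSpan.fundamentalDomain (intBasis K s), ∑' y : Fin (s + 1) → 𝓞 K,
      ({y | y ≠ 0} : Set _).indicator (fun y => f (shear q⁻¹ ε α (intEmb K (s + 1) y))) y) *
        volume (ZSpan.fundamentalDomain (latticeBasis K)) =
      ∫⁻ u : mixedSpace K × (Fin s → mixedSpace K),
        if (ZSpan.floor (latticeBasis K) (q • u.1) : mixedSpace K) = 0 then 0 else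
          f (Fin.cons (q⁻¹ • (ZSpan.floor (latticeBasis K) (q • u.1) : mixedSpace K)) u.2) := by
  have hcons : ∀ c : mixedSpace K, Measurable fun z : Fin s → mixedSpace K =>
      f (Fin.cons c z : Fin (s + 1) → mixedSpace K) := fun c =>
    hf.comp ((measurable_cons s).comp (measurable_const.prodMk measurable_id))
  set d := Module.finrank ℚ K
  let G : mixedSpace K → ℝ≥0∞ := fun x =>
    if x = 0 then 0 else ∫⁻ z : Fin s → mixedSpace K, f (Fin.cons (q⁻¹ • x) z)
  -- the sum over the first coordinate
  have h1 : ∀ α : Fin s → mixedSpace K, ∑' y : Fin (s + 1) → 𝓞 K,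
      ({y | y ≠ 0} : Set _).indicator (fun y => f (shear q⁻¹ ε α (intEmb K (s + 1) y))) y =
      ∑' a : 𝓞 K, if a = 0 then 0 else ∑' y : Fin s → 𝓞 K,
        f (Fin.cons (q⁻¹ • mixedEmbedding K (a : K))
          (ε • (intEmb K s y + fun j => mixedEmbedding K (a : K) * α j))) := by
    intro α
    rw [← (Fin.consEquiv fun _ => 𝓞 K).tsum_eq, ENNReal.tsum_prod']
    refine tsum_congr fun a => ?_
    have h2 : ∀ y : Fin s → 𝓞 K, shear q⁻¹ ε α (intEmb K (s + 1)
        ((Fin.consEquiv fun _ => 𝓞 K) (a, y))) =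
        Fin.cons (q⁻¹ • mixedEmbedding K (a : K))
          (ε • (intEmb K s y + fun j => mixedEmbedding K (a : K) * α j)) := by
      intro y
      funext j
      refine Fin.cases ?_ (fun j => ?_) j
      · simp
      · simp
    split_ifs with ha
    · refine ENNReal.tsum_eq_zero.2 fun y => ?_
      refine Set.indicator_apply_eq_zero.2 fun hy => ?_
      rw [h2]
      by_contra hne
      have hy0 : y ≠ 0 := by
        rintro rfl
        apply hy
        funext j
        refine Fin.cases ?_ (fun j => ?_) j
        · simp [ha]
        · simp
      have h3 := hB _ hne
      have h4 : ‖ε • intEmb K s y‖ ≤ B := by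
        refine le_trans ?_ h3
        refine (pi_norm_le_iff_of_nonneg (norm_nonneg _)).2 fun j => ?_
        refine le_trans (le_of_eq ?_) (norm_le_pi_norm _ j.succ)
        simp [ha]
      rw [_root_.norm_smul, Real.norm_of_nonneg hε0.le] at h4
      nlinarith [one_le_norm_intEmb hy0]
    · refine tsum_congr fun y => ?_
      rw [← h2, Set.indicator_of_mem]
      intro h
      exact ha (congr_fun h 0)
  have h2 : ∫⁻ α in ZSpan.fundamentalDomain (intBasis K s), ∑' y : Fin (s + 1) → 𝓞 K,
      ({y | y ≠ 0} : Set _).indicator (fun y => f (shear q⁻¹ ε α (intEmb K (s + 1) y))) y =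
      ∑' a : 𝓞 K, (ENNReal.ofReal (q⁻¹ ^ d)) * G (mixedEmbedding K (a : K)) := by
    simp_rw [h1]
    rw [lintegral_tsum]
    · refine tsum_congr fun a => ?_
      by_cases ha : a = 0
      · simp [ha, G]
      · have ha' : mixedEmbedding K (a : K) ≠ 0 := by simpa using ha
        simp only [ha, G, ha', if_false]
        have hm : Measurable fun z : Fin s → mixedSpace K =>
            f (Fin.cons (q⁻¹ • mixedEmbedding K (a : K)) (ε • z) : Fin (s + 1) → mixedSpace K) :=
          (hcons _).comp (measurable_const_smul ε)
        rw [setLIntegral_tsum_shear ha hm, ← lintegral_comp_smul volume hε0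
          (fun z : Fin s → mixedSpace K => f (Fin.cons (q⁻¹ • mixedEmbedding K (a : K)) z)),
          ← mul_assoc, ← ENNReal.ofReal_mul (by positivity), finrank_pi_mixedSpace, pow_mul, hεq,
          ← mul_pow, inv_mul_cancel₀ hq.ne', one_pow, ENNReal.ofReal_one, one_mul]
    · intro a
      split_ifs with ha
      · exact aemeasurable_const
      · refine (Measurable.tsum fun y => ?_).aemeasurable
        refine (hcons _).comp ?_
        refine Measurable.const_smul (Measurable.const_add ?_ _) ε
        exact measurable_pi_lambda _ fun j => (measurable_pi_apply j).const_mul _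
  have h3 : ∑' a : 𝓞 K, (ENNReal.ofReal (q⁻¹ ^ d)) * G (mixedEmbedding K (a : K)) =
      ∑' x : Submodule.span ℤ (Set.range (latticeBasis K)), (ENNReal.ofReal (q⁻¹ ^ d)) * G x := by
    let e : 𝓞 K ≃ Submodule.span ℤ (Set.range (latticeBasis K)) :=
      Equiv.ofBijective (fun a => ⟨mixedEmbedding K (a : K),
        (mem_span_latticeBasis K).2 ⟨a, rfl⟩⟩)
        ⟨fun x y h => RingOfIntegers.coe_injective
          (mixedEmbedding_injective K (congr_arg Subtype.val h)), fun x => by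
          obtain ⟨a, ha⟩ := (mem_span_latticeBasis K).1 x.2
          exact ⟨a, Subtype.ext ha⟩⟩
    exact e.tsum_eq fun x => (ENNReal.ofReal (q⁻¹ ^ d)) * G x
  rw [h2, h3, tsum_mul_measure_fundamentalDomain (latticeBasis K) volume
    fun x => (ENNReal.ofReal (q⁻¹ ^ d)) * G x, ← lintegral_comp_smul volume hq,
    mixedEmbedding.finrank, lintegral_const_mul']
  · rw [← mul_assoc, ← ENNReal.ofReal_mul (by positivity), ← mul_pow, mul_inv_cancel₀ hq.ne',
      one_pow, ENNReal.ofReal_one, one_mul,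
      Measure.volume_eq_prod (mixedSpace K) (Fin s → mixedSpace K),
      lintegral_prod _ (measurable_ite_floor hf q).aemeasurable]
    refine lintegral_congr fun x => ?_
    simp only [G]
    split_ifs
    · simp
    · rfl
  · exact ENNReal.ofReal_ne_top

theorem lintegral_cons {s : ℕ} (f : (Fin (s + 1) → mixedSpace K) → ℝ≥0∞) :
    ∫⁻ u : mixedSpace K × (Fin s → mixedSpace K), f (Fin.cons u.1 u.2) = ∫⁻ x, f x := by
  have h := (volume_preserving_piFinSuccAbove (fun _ : Fin (s + 1) => mixedSpace K) 0).symm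
  rw [← h.lintegral_comp_emb (MeasurableEquiv.measurableEmbedding _)]
  refine lintegral_congr fun u => congr_arg f ?_
  exact (Fin.insertNth_zero' u.1 u.2).symm

/-- Convergence of the Riemann sums of mesh `1 / q` in the first coordinate. -/
theorem tendsto_lintegral_floor {s : ℕ} {f : (Fin (s + 1) → mixedSpace K) → ℝ≥0}
    (hf : Continuous f) {B : ℝ} (hB : ∀ x, f x ≠ 0 → ‖x‖ ≤ B) :
    Tendsto (fun q : ℕ => ∫⁻ u : mixedSpace K × (Fin s → mixedSpace K),
        if (ZSpan.floor (latticeBasis K) ((q : ℝ) • u.1) : mixedSpace K) = 0 then 0 else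
          (f (Fin.cons ((q : ℝ)⁻¹ • (ZSpan.floor (latticeBasis K) ((q : ℝ) • u.1) : mixedSpace K))
            u.2) : ℝ≥0∞)) atTop (𝓝 (∫⁻ x, f x)) := by
  rw [← lintegral_cons]
  obtain ⟨C, hC⟩ : ∃ C, ∀ x, f x ≤ C := by
    obtain ⟨C, hC⟩ := (isCompact_closedBall (0 : Fin (s + 1) → mixedSpace K) B).bddAbove_image
      hf.continuousOn
    refine ⟨C, fun x => ?_⟩
    by_cases hx : f x = 0
    · rw [hx]; exact zero_le
    · exact hC ⟨x, by simpa using hB x hx, rfl⟩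
  set δ := ∑ i, ‖latticeBasis K i‖
  have hδ0 : 0 ≤ δ := Finset.sum_nonneg fun i _ => norm_nonneg _
  -- rounding to the grid of mesh `1 / q` moves points by at most `δ / q`
  have hdist : ∀ (q : ℕ), 0 < q → ∀ x : mixedSpace K,
      ‖(q : ℝ)⁻¹ • (ZSpan.floor (latticeBasis K) ((q : ℝ) • x) : mixedSpace K) - x‖ ≤
        (q : ℝ)⁻¹ * δ := by
    intro q hq x
    have hq' : (q : ℝ) ≠ 0 := by positivity
    have h1 : (q : ℝ)⁻¹ • (ZSpan.floor (latticeBasis K) ((q : ℝ) • x) : mixedSpace K) - x =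
        -((q : ℝ)⁻¹ • ZSpan.fract (latticeBasis K) ((q : ℝ) • x)) := by
      rw [ZSpan.fract_apply, smul_sub, smul_smul, inv_mul_cancel₀ hq', one_smul]
      abel
    rw [h1, norm_neg, _root_.norm_smul, Real.norm_of_nonneg (by positivity)]
    gcongr
    exact ZSpan.norm_fract_le _ _
  refine tendsto_lintegral_filter_of_dominated_convergence
    ((Metric.closedBall (0 : mixedSpace K × (Fin s → mixedSpace K)) (B + δ)).indicator fun _ => C)
    (Eventually.of_forall fun q => measurable_ite_floor hf.measurable.coe_nnreal_ennreal q)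
    ?_ ?_ ?_
  · filter_upwards [eventually_gt_atTop 0] with q hq
    refine Eventually.of_forall fun u => ?_
    split_ifs with h0
    · exact zero_le
    · by_cases h1 : f (Fin.cons ((q : ℝ)⁻¹ •
          (ZSpan.floor (latticeBasis K) ((q : ℝ) • u.1) : mixedSpace K)) u.2) = 0
      · rw [h1]; simp
      · rw [Set.indicator_of_mem]
        · exact_mod_cast hC _
        · have h2 := hB _ h1
          have h3 := (norm_le_pi_norm _ 0).trans h2
          rw [Fin.cons_zero] at h3
          have h5 : (q : ℝ)⁻¹ * δ ≤ δ :=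
            mul_le_of_le_one_left hδ0 (inv_le_one_of_one_le₀ (by exact_mod_cast hq))
          rw [mem_closedBall_zero_iff, Prod.norm_def, max_le_iff]
          constructor
          · have h4 := hdist q hq u.1
            have h6 := norm_sub_norm_le u.1 ((q : ℝ)⁻¹ •
              (ZSpan.floor (latticeBasis K) ((q : ℝ) • u.1) : mixedSpace K))
            rw [norm_sub_rev] at h6
            linarith
          · refine (pi_norm_le_iff_of_nonneg (by linarith [(norm_nonneg _).trans h3])).2 fun j => ?_
            have h4 := (norm_le_pi_norm _ j.succ).trans h2
            rw [Fin.cons_succ] at h4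
            linarith
  · rw [lintegral_indicator_const measurableSet_closedBall]
    exact ENNReal.mul_ne_top ENNReal.coe_ne_top measure_closedBall_lt_top.ne
  · have hnull : ∀ᵐ u : mixedSpace K × (Fin s → mixedSpace K), u.1 ≠ 0 := by
      have h1 : ∀ᵐ x : mixedSpace K, x ≠ 0 := by
        simp [ae_iff]
      exact Measure.quasiMeasurePreserving_fst.ae h1
    filter_upwards [hnull] with u hu
    have h1 : Tendsto (fun q : ℕ => (q : ℝ)⁻¹ •
        (ZSpan.floor (latticeBasis K) ((q : ℝ) • u.1) : mixedSpace K)) atTop (𝓝 u.1) := by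
      rw [tendsto_iff_norm_sub_tendsto_zero]
      refine squeeze_zero' (Eventually.of_forall fun q => norm_nonneg _)
        ((eventually_gt_atTop 0).mono fun q hq => hdist q hq u.1) ?_
      simpa using tendsto_inv_atTop_nhds_zero_nat.mul_const δ
    have h2 : Continuous fun c : mixedSpace K => (f (Fin.cons c u.2) : ℝ≥0∞) := by
      refine ENNReal.continuous_coe.comp (hf.comp (continuous_pi fun j => ?_))
      refine Fin.cases ?_ (fun j => ?_) j
      · exact continuous_id
      · exact continuous_const
    refine ((h2.tendsto u.1).comp h1).congr' ?_
    filter_upwards [h1.eventually_ne hu] with q hq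
    rw [if_neg]
    · rfl
    · intro h
      exact hq (by rw [h, smul_zero])

end

/-! ### Sieving by primes -/

section

variable {K : Type*} [Field K] 

variable (K) in
/-- The nonzero vectors of `(𝓞 K) ^ t` that are divisible by no element of `Q`. For a finite set `Q`
of primes these stand in for the vectors that are primitive over `ℤ`. -/
def sieved (t : ℕ) (Q : Finset ℕ) : Set (Fin t → 𝓞 K) :=
  {y | y ≠ 0 ∧ ∀ p ∈ Q, ∀ z, y ≠ p • z}

variable [NumberField K]

theorem nsmul_injective {t : ℕ} {p : ℕ} (hp : p ≠ 0) :
    Function.Injective fun z : Fin t → 𝓞 K => p • z := fun x y h => by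
  funext j
  have := congr_fun h j
  simpa [hp] using this

theorem nsmul_mem_sieved {t : ℕ} {Q : Finset ℕ} (hQ : ∀ q ∈ Q, q.Prime) {p : ℕ} (hp : p.Prime)
    (hpQ : p ∉ Q) {z : Fin t → 𝓞 K} : p • z ∈ sieved K t Q ↔ z ∈ sieved K t Q := by
  have hinj := nsmul_injective (K := K) (t := t) hp.ne_zero
  refine and_congr (not_congr ⟨fun h => hinj (by simpa using h), fun h => by simp [h]⟩)
    (forall₂_congr fun q hq => ⟨fun h w hw => h (p • w) ?_, fun h w hw => ?_⟩)
  · rw [hw, smul_comm]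
  · have hcop : IsCoprime (p : ℤ) q :=
      Nat.isCoprime_iff_coprime.2 ((Nat.coprime_primes hp (hQ q hq)).2 fun h => hpQ (h ▸ hq))
    obtain ⟨a, b, hab⟩ := hcop
    refine h (a • w + b • z) ?_
    calc z = (a * p + b * q : ℤ) • z := by rw [hab, one_smul]
      _ = a • (p • z) + q • (b • z) := by
        rw [add_smul, mul_smul, mul_comm b, mul_smul, natCast_zsmul, natCast_zsmul]
      _ = q • (a • w + b • z) := by rw [hw, smul_add, smul_comm]

/-- One step of the sieve: by `nsmul_mem_sieved`, the vectors that the prime `p` removes are the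
`p`-multiples of the vectors sieved so far. -/
theorem tsum_indicator_sieved_insert {t : ℕ} {Q : Finset ℕ} (hQ : ∀ q ∈ Q, q.Prime) {p : ℕ}
    (hp : p.Prime) (hpQ : p ∉ Q) (F : (Fin t → 𝓞 K) → ℝ≥0∞) :
    ∑' y, (sieved K t (insert p Q)).indicator F y +
      ∑' y, (sieved K t Q).indicator (fun y => F (p • y)) y =
        ∑' y, (sieved K t Q).indicator F y := by
  have h1 : ∑' y, (sieved K t Q).indicator (fun y => F (p • y)) y =
      ∑' y, (Set.range fun z : Fin t → 𝓞 K => p • z).indicator ((sieved K t Q).indicator F) y := by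
    rw [← (nsmul_injective (K := K) (t := t) hp.ne_zero).tsum_eq
      (f := (Set.range fun z : Fin t → 𝓞 K => p • z).indicator ((sieved K t Q).indicator F))
      (Set.support_indicator_subset)]
    refine tsum_congr fun y => ?_
    rw [Set.indicator_of_mem (Set.mem_range_self y)]
    by_cases hy : y ∈ sieved K t Q
    · rw [Set.indicator_of_mem hy, Set.indicator_of_mem ((nsmul_mem_sieved hQ hp hpQ).2 hy)]
    · rw [Set.indicator_of_notMem hy,
        Set.indicator_of_notMem (mt (nsmul_mem_sieved hQ hp hpQ).1 hy)]
  rw [h1, ← ENNReal.tsum_add]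
  refine tsum_congr fun y => ?_
  have h2 : y ∈ sieved K t (insert p Q) ↔
      y ∈ sieved K t Q ∧ y ∉ Set.range fun z : Fin t → 𝓞 K => p • z := by
    simp only [sieved, Finset.mem_insert, forall_eq_or_imp, Set.mem_range, not_exists,
      Set.mem_ofPred_eq, ne_eq]
    constructor
    · rintro ⟨h, h', h''⟩
      exact ⟨⟨h, h''⟩, fun z hz => h' z hz.symm⟩
    · rintro ⟨⟨h, h''⟩, h'⟩
      exact ⟨h, fun z hz => h' z hz.symm, h''⟩
  simp only [Set.indicator, h2]
  by_cases hr : y ∈ Set.range fun z : Fin t → 𝓞 K => p • z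
  · rw [if_neg fun h => h.2 hr, if_pos hr, zero_add]
  · simp only [hr, not_false_eq_true, and_true, if_false, add_zero]

theorem measurable_tsum_shear {s : ℕ} {f : (Fin (s + 1) → mixedSpace K) → ℝ≥0∞} (hf : Measurable f)
    (Q : Finset ℕ) (η ε : ℝ) : Measurable fun α : Fin s → mixedSpace K =>
      ∑' y, (sieved K (s + 1) Q).indicator (fun y => f (shear η ε α (intEmb K (s + 1) y))) y := by
  refine Measurable.tsum fun y => ?_
  by_cases hy : y ∈ sieved K (s + 1) Q
  · simp only [Set.indicator_of_mem hy]
    refine hf.comp (measurable_pi_lambda _ fun j => ?_)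
    refine Fin.cases ?_ (fun j => ?_) j
    · simp
    · simp only [shear_apply_succ]
      exact (((measurable_pi_apply j).const_mul _).const_add _).const_smul ε
  · simp only [Set.indicator_of_notMem hy]
    exact measurable_const

theorem lintegral_ne_top_of_bounded_support {t : ℕ} {f : (Fin t → mixedSpace K) → ℝ≥0}
    (hf : Continuous f) {B : ℝ} (hB : ∀ x, f x ≠ 0 → ‖x‖ ≤ B) : ∫⁻ x, (f x : ℝ≥0∞) ≠ ∞ := by
  have h1 : HasCompactSupport f := HasCompactSupport.intro
    (isCompact_closedBall (0 : Fin t → mixedSpace K) B) fun x hx => by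
      by_contra h
      exact hx (by simpa using hB x h)
  have h2 : Integrable (fun x => (f x : ℝ)) :=
    (NNReal.continuous_coe.comp hf).integrable_of_hasCompactSupport
      (h1.comp_left (g := ((↑) : ℝ≥0 → ℝ)) rfl)
  simpa using h2.lintegral_lt_top.ne

theorem lintegral_natCast_smul {t p : ℕ} (hp : 0 < p) (f : (Fin t → mixedSpace K) → ℝ≥0∞) :
    ∫⁻ x : Fin t → mixedSpace K, f ((p : ℝ) • x) =
      ENNReal.ofReal ((p : ℝ) ^ (t * Module.finrank ℚ K))⁻¹ * ∫⁻ x, f x := by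
  have hp' : (0 : ℝ) < p := by exact_mod_cast hp
  have hpN : (0 : ℝ) < (p : ℝ) ^ (t * Module.finrank ℚ K) := pow_pos hp' _
  rw [← lintegral_comp_smul volume hp' f, finrank_pi_mixedSpace, ← mul_assoc,
    ← ENNReal.ofReal_mul (inv_pos.2 hpN).le, inv_mul_cancel₀ hpN.ne', ENNReal.ofReal_one, one_mul]

/-- Mean value theorem: the average over the shears of the sum of `f` over the sieved vectors tends
to the integral of `f`, up to the covolume and the Euler factors at the primes of `Q`. For the
inductive step, the `p`-multiples contribute the mean value of `x ↦ f (p x)`, whose integral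
is `p ^ (-N)` times that of `f`. -/
theorem tendsto_mean {s : ℕ} (hs : s ≠ 0) {f : (Fin (s + 1) → mixedSpace K) → ℝ≥0}
    (hf : Continuous f) {B : ℝ} (hB : ∀ x, f x ≠ 0 → ‖x‖ ≤ B) {Q : Finset ℕ}
    (hQ : ∀ q ∈ Q, q.Prime) :
    Tendsto (fun q : ℕ => (∫⁻ α in ZSpan.fundamentalDomain (intBasis K s),
      ∑' y, (sieved K (s + 1) Q).indicator
        (fun y => (f (shear (q : ℝ)⁻¹ ((q : ℝ) ^ (s : ℝ)⁻¹) α (intEmb K (s + 1) y)) : ℝ≥0∞)) y) *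
          volume (ZSpan.fundamentalDomain (latticeBasis K))) atTop
      (𝓝 (ENNReal.ofReal (∏ p ∈ Q, (1 - ((p : ℝ) ^ ((s + 1) * Module.finrank ℚ K))⁻¹)) *
        ∫⁻ x, f x)) := by
  induction Q using Finset.induction_on generalizing f with
  | empty =>
    simp only [Finset.prod_empty, ENNReal.ofReal_one, one_mul]
    refine (tendsto_lintegral_floor hf hB).congr' ?_
    filter_upwards [eventually_gt_atTop 0, tendsto_natCast_atTop_atTop.eventually
      ((tendsto_rpow_atTop (y := (s : ℝ)⁻¹) (by positivity)).eventually_gt_atTop B)] with q hq hε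
    have hq' : (0 : ℝ) < q := by exact_mod_cast hq
    rw [← lintegral_tsum_shear (f := fun x => (f x : ℝ≥0∞)) hf.measurable.coe_nnreal_ennreal
      (B := B) (fun x hx => hB x (by simpa using hx)) hq' hε (by positivity)
      (by rw [← Real.rpow_natCast, ← Real.rpow_mul hq'.le, inv_mul_cancel₀ (by positivity),
        Real.rpow_one])]
    simp [sieved]
  | insert p Q hpQ ih =>
    have hp := hQ p (Finset.mem_insert_self p Q)
    have hQ' : ∀ q ∈ Q, q.Prime := fun q hq => hQ q (Finset.mem_insert_of_mem hq)
    have h1 := ih hf hB hQ'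
    have hfp : Continuous fun x => f ((p : ℝ) • x) := hf.comp (continuous_const_smul _)
    have h2 := ih hfp (fun x hx => by
      have := hB _ hx
      rw [_root_.norm_smul, Real.norm_natCast] at this
      refine le_trans (le_mul_of_one_le_left (norm_nonneg x) ?_) this
      exact_mod_cast hp.one_le) hQ'
    have hI := lintegral_ne_top_of_bounded_support hf hB
    set N := (s + 1) * Module.finrank ℚ K with hN
    have hpN : (0 : ℝ) < (p : ℝ) ^ N := pow_pos (by exact_mod_cast hp.pos) N
    have hscale := lintegral_natCast_smul hp.pos fun x => (f x : ℝ≥0∞)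
    rw [hscale, ← hN] at h2
    have hfin : ENNReal.ofReal (∏ p ∈ Q, (1 - ((p : ℝ) ^ N)⁻¹)) *
        (ENNReal.ofReal ((p : ℝ) ^ N)⁻¹ * ∫⁻ x, (f x : ℝ≥0∞)) ≠ ∞ := by finiteness
    have hP : 0 ≤ ∏ p ∈ Q, (1 - ((p : ℝ) ^ N)⁻¹) := Finset.prod_nonneg fun q hq => by
      have : (1 : ℝ) ≤ (q : ℝ) ^ N := one_le_pow₀ (by exact_mod_cast (hQ' q hq).one_le)
      linarith [inv_le_one_of_one_le₀ this]
    have hval : ENNReal.ofReal (∏ p ∈ insert p Q, (1 - ((p : ℝ) ^ N)⁻¹)) * ∫⁻ x, (f x : ℝ≥0∞) =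
        ENNReal.ofReal (∏ p ∈ Q, (1 - ((p : ℝ) ^ N)⁻¹)) * (∫⁻ x, (f x : ℝ≥0∞)) -
        ENNReal.ofReal (∏ p ∈ Q, (1 - ((p : ℝ) ^ N)⁻¹)) *
        (ENNReal.ofReal ((p : ℝ) ^ N)⁻¹ * ∫⁻ x, (f x : ℝ≥0∞)) := by
      rw [Finset.prod_insert hpQ, ← mul_assoc, ← ENNReal.sub_mul (fun _ _ => hI),
        ← ENNReal.ofReal_mul hP, ← ENNReal.ofReal_sub _ (by positivity)]
      congr 2
      ring
    rw [hval]
    refine (ENNReal.Tendsto.sub h1 h2 (Or.inr hfin)).congr' ?_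
    filter_upwards [h2.eventually_ne hfin] with q hq
    refine (ENNReal.eq_sub_of_add_eq hq ?_).symm
    rw [← add_mul, ← lintegral_add_left (measurable_tsum_shear
      hf.measurable.coe_nnreal_ennreal _ _ _)]
    congr 1
    refine lintegral_congr fun α => ?_
    refine Eq.trans ?_ (tsum_indicator_sieved_insert hQ' hp hpQ _)
    simp only [map_nsmul, Nat.cast_smul_eq_nsmul]

/-- The finite Euler products of `1 / ζ(N)` converge to it. -/
theorem tendsto_prod_primesBelow {N : ℕ} (hN : 1 < N) :
    Tendsto (fun m : ℕ => ∏ p ∈ m.primesBelow, (1 - ((p : ℝ) ^ N)⁻¹)) atTop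
      (𝓝 ((riemannZeta (N : ℂ)).re)⁻¹) := by
  have h1 := riemannZeta_eulerProduct (s := (N : ℂ)) (by simpa using hN)
  have h2 := (Complex.continuous_re.tendsto _).comp h1
  have h3 : ∀ m : ℕ, (Complex.re ∘ fun m : ℕ => ∏ p ∈ m.primesBelow, (1 - (p : ℂ) ^ (-(N : ℂ)))⁻¹) m
      = (∏ p ∈ m.primesBelow, (1 - ((p : ℝ) ^ N)⁻¹))⁻¹ := by
    intro m
    rw [Function.comp_apply, ← Complex.ofReal_re ((∏ p ∈ m.primesBelow, (1 - ((p : ℝ) ^ N)⁻¹))⁻¹)]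
    congr 1
    push_cast
    rw [← Finset.prod_inv_distrib]
    refine Finset.prod_congr rfl fun p _ => ?_
    rw [Complex.cpow_neg, Complex.cpow_natCast]
  have h4 := (h2.congr h3).inv₀ (by
    exact_mod_cast (riemannZeta_re_pos_of_one_lt (x := (N : ℝ)) (by exact_mod_cast hN)).ne')
  simpa using h4

end

/-! ### The Euclidean norm and the cut-off function -/

section

variable {K : Type*} [Field K] [NumberField K] {t : ℕ}

theorem traceForm_nonneg (x : mixedSpace K) : 0 ≤ traceForm x :=
  Finset.sum_nonneg fun _ _ => by positivity

theorem euclNorm_nonneg (x : Fin t → mixedSpace K) : 0 ≤ euclNorm x := Real.sqrt_nonneg _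

theorem euclNorm_smul (c : ℝ) (x : Fin t → mixedSpace K) : euclNorm (c • x) = |c| * euclNorm x := by
  have : ∑ j, traceForm ((c • x) j) = c ^ 2 * ∑ j, traceForm (x j) := by
    simp_rw [Finset.mul_sum, traceForm, Finset.mul_sum, Pi.smul_apply, normAtPlace_smul, mul_pow,
      sq_abs]
    refine Finset.sum_congr rfl fun j _ => Finset.sum_congr rfl fun w _ => ?_
    ring
  rw [euclNorm, this, Real.sqrt_mul (sq_nonneg c), Real.sqrt_sq_eq_abs, euclNorm]

theorem continuous_euclNorm : Continuous (euclNorm : (Fin t → mixedSpace K) → ℝ) := by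
  refine Real.continuous_sqrt.comp (continuous_finsetSum _ fun j _ => ?_)
  refine continuous_finsetSum _ fun w _ => ?_
  exact (((continuous_normAtPlace w).comp (continuous_apply j)).pow 2).const_mul _

theorem norm_le_euclNorm (x : Fin t → mixedSpace K) : ‖x‖ ≤ euclNorm x := by
  refine (pi_norm_le_iff_of_nonneg (euclNorm_nonneg x)).2 fun j => ?_
  rw [norm_eq_sup'_normAtPlace]
  refine Finset.sup'_le _ _ fun w _ => Real.le_sqrt_of_sq_le ?_
  calc normAtPlace w (x j) ^ 2 ≤ (w.mult : ℝ) * normAtPlace w (x j) ^ 2 :=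
        le_mul_of_one_le_left (sq_nonneg _) (by exact_mod_cast InfinitePlace.one_le_mult)
    _ ≤ traceForm (x j) := Finset.single_le_sum
        (f := fun w => (w.mult : ℝ) * normAtPlace w (x j) ^ 2)
        (fun w _ => by positivity) (Finset.mem_univ w)
    _ ≤ ∑ j, traceForm (x j) := Finset.single_le_sum
        (f := fun j => traceForm (x j)) (fun j _ => traceForm_nonneg _) (Finset.mem_univ j)

theorem euclNorm_pos {x : Fin t → mixedSpace K} (hx : x ≠ 0) : 0 < euclNorm x :=
  (norm_pos_iff.2 hx).trans_le (norm_le_euclNorm x)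

theorem euclNorm_eq_of_normAtPlace {x y : Fin t → mixedSpace K}
    (h : ∀ w, ∑ j, normAtPlace w (x j) ^ 2 = ∑ j, normAtPlace w (y j) ^ 2) :
    euclNorm x = euclNorm y := by
  unfold euclNorm traceForm
  rw [Finset.sum_comm, Finset.sum_comm (γ := Fin t)]
  simp_rw [← Finset.mul_sum, h]

variable (K t) in
theorem volume_euclBall_ne_zero : volume {x : Fin t → mixedSpace K | euclNorm x ≤ 1} ≠ 0 := by
  have h1 : {x : Fin t → mixedSpace K | euclNorm x < 1} ⊆ {x | euclNorm x ≤ 1} := fun x hx =>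
    (show euclNorm x < 1 from hx).le
  refine fun h => (IsOpen.measure_pos volume (isOpen_lt continuous_euclNorm continuous_const)
    ⟨0, ?_⟩).ne' (measure_mono_null h1 h)
  have := euclNorm_smul (0 : ℝ) (0 : Fin t → mixedSpace K)
  simp at this
  simp [this]

theorem volume_euclBall_ne_top (ρ : ℝ) :
    volume {x : Fin t → mixedSpace K | euclNorm x ≤ ρ} ≠ ∞ := by
  refine ne_top_of_le_ne_top (measure_closedBall_lt_top (x := (0 : Fin t → mixedSpace K))
    (r := ρ)).ne (measure_mono fun x hx => ?_)
  rw [mem_closedBall_zero_iff]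
  exact (norm_le_euclNorm x).trans hx

theorem volume_euclBall {ρ : ℝ} (hρ : 0 < ρ) :
    volume {x : Fin t → mixedSpace K | euclNorm x ≤ ρ} =
      ENNReal.ofReal (ρ ^ (t * Module.finrank ℚ K)) *
        volume {x : Fin t → mixedSpace K | euclNorm x ≤ 1} := by
  have h1 : {x : Fin t → mixedSpace K | euclNorm x ≤ ρ} = ρ • {x | euclNorm x ≤ 1} := by
    ext x
    rw [Set.mem_smul_set_iff_inv_smul_mem₀ hρ.ne', Set.mem_ofPred_eq, Set.mem_ofPred_eq,
      euclNorm_smul, abs_of_pos (inv_pos.2 hρ), inv_mul_le_iff₀ hρ, mul_one]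
  rw [h1, Measure.addHaar_smul, finrank_pi_mixedSpace, abs_of_pos (pow_pos hρ _)]

/-- The function `1 / t - n log (ρ / R)` of `ρ`, truncated to the interval `[0, 1]`. The truncation
from above is done by replacing `ρ` by its maximum with the point where the value `1` is taken,
which also keeps the argument of the logarithm away from `0`. -/
def radial (t n : ℕ) (R ρ : ℝ) : ℝ :=
  max 0 ((t : ℝ)⁻¹ - n * Real.log (max ρ (R * Real.exp (((t : ℝ)⁻¹ - 1) / n)) / R))

section radial
variable {n : ℕ} {R : ℝ}

theorem continuous_radial (hR : 0 < R) : Continuous (radial t n R) := by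
  have h0 : 0 < R * Real.exp (((t : ℝ)⁻¹ - 1) / n) := mul_pos hR (Real.exp_pos _)
  refine continuous_const.max (continuous_const.sub (continuous_const.mul
    (Continuous.log ?_ fun ρ => ?_)))
  · fun_prop
  · exact (div_pos (lt_max_of_lt_right h0) hR).ne'

theorem radial_nonneg (ρ : ℝ) : 0 ≤ radial t n R ρ := le_max_left _ _

theorem le_radial_iff (hn : 0 < n) (hR : 0 < R) {σ ρ : ℝ} (hσ : 0 < σ) (hσ1 : σ ≤ 1) :
    σ ≤ radial t n R ρ ↔ ρ ≤ R * Real.exp (((t : ℝ)⁻¹ - σ) / n) := by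
  have h0 : 0 < R * Real.exp (((t : ℝ)⁻¹ - 1) / n) := mul_pos hR (Real.exp_pos _)
  have hn' : (0 : ℝ) < n := by exact_mod_cast hn
  rw [radial, le_max_iff, or_iff_right hσ.not_ge, le_sub_comm, ← le_div_iff₀' hn',
    Real.log_le_iff_le_exp (div_pos (lt_max_of_lt_right h0) hR), div_le_iff₀' hR, max_le_iff,
    and_iff_left]
  gcongr

theorem radial_le_one (hn : 0 < n) (hR : 0 < R) (ρ : ℝ) : radial t n R ρ ≤ 1 := by
  have h0 : 0 < R * Real.exp (((t : ℝ)⁻¹ - 1) / n) := mul_pos hR (Real.exp_pos _)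
  have hn' : (0 : ℝ) < n := by exact_mod_cast hn
  refine max_le zero_le_one ?_
  have h1 : ((t : ℝ)⁻¹ - 1) / n ≤ Real.log (max ρ (R * Real.exp (((t : ℝ)⁻¹ - 1) / n)) / R) := by
    rw [Real.le_log_iff_exp_le (div_pos (lt_max_of_lt_right h0) hR), le_div_iff₀' hR]
    exact le_max_right _ _
  rw [div_le_iff₀' hn'] at h1
  linarith

theorem le_of_radial_ne_zero (hn : 0 < n) (hR : 0 < R) {ρ : ℝ} (h : radial t n R ρ ≠ 0) :
    ρ ≤ R * Real.exp ((t : ℝ)⁻¹ / n) := by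
  have h1 : 0 < radial t n R ρ := (radial_nonneg ρ).lt_of_ne' h
  refine ((le_radial_iff hn hR h1 (radial_le_one hn hR ρ)).1 le_rfl).trans ?_
  gcongr
  linarith

/-- Below `1`, the truncated function is bounded below by the logarithm that it truncates. -/
theorem sub_log_le_radial {ρ : ℝ} (hR : 0 < R) (h : radial t n R ρ < 1) (hn : 0 < n) :
    (t : ℝ)⁻¹ - n * Real.log (ρ / R) ≤ radial t n R ρ := by
  have h1 := mt (le_radial_iff (t := t) hn hR one_pos le_rfl).2 h.not_ge
  rw [radial, max_eq_left (not_le.1 h1).le]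
  exact le_max_right _ _

/-- By the layer cake formula: the set where the function is at least `σ ∈ (0, 1]` is the ball of
radius `R exp ((1 / t - σ) / n)`, whose volume is `exp (1 - t σ)` times that of the ball of radius
`R`. -/
theorem lintegral_radial (ht : 0 < t) (hR : 0 < R) :
    ∫⁻ x : Fin t → mixedSpace K, ENNReal.ofReal (radial t (Module.finrank ℚ K) R (euclNorm x)) =
      ENNReal.ofReal (R ^ (t * Module.finrank ℚ K) * (Real.exp 1 * (1 - Real.exp (-(t : ℝ))) / t)) *
        volume {x : Fin t → mixedSpace K | euclNorm x ≤ 1} := by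
  have hn : 0 < Module.finrank ℚ K := Module.finrank_pos
  set n := Module.finrank ℚ K
  have hn' : (0 : ℝ) < n := by exact_mod_cast hn
  have ht' : (0 : ℝ) < t := by exact_mod_cast ht
  rw [lintegral_eq_lintegral_meas_le volume (Eventually.of_forall fun x => radial_nonneg _)
    (((continuous_radial hR).comp continuous_euclNorm).aemeasurable)]
  have h1 : ∫⁻ σ in Set.Ioi (0 : ℝ),
      volume {x : Fin t → mixedSpace K | σ ≤ radial t n R (euclNorm x)} =
      ∫⁻ σ in Set.Ioi (0 : ℝ), (Set.Ioc (0 : ℝ) 1).indicator (fun σ =>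
        ENNReal.ofReal (R ^ (t * n) * Real.exp (1 - t * σ)) *
          volume {x : Fin t → mixedSpace K | euclNorm x ≤ 1}) σ := by
    refine setLIntegral_congr_fun measurableSet_Ioi fun σ hσ => ?_
    by_cases h : σ ≤ 1
    · rw [Set.indicator_of_mem (show σ ∈ Set.Ioc (0 : ℝ) 1 from ⟨hσ, h⟩)]
      simp_rw [le_radial_iff hn hR hσ h]
      rw [volume_euclBall (mul_pos hR (Real.exp_pos _)), mul_pow, ← Real.exp_nat_mul]
      congr 4
      push_cast
      field_simp
      exact mul_comm _ _
    · rw [Set.indicator_of_notMem fun h' => h h'.2]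
      have : {x : Fin t → mixedSpace K | σ ≤ radial t n R (euclNorm x)} = ∅ :=
        Set.eq_empty_of_forall_notMem fun x hx => h (le_trans hx (radial_le_one hn hR _))
      rw [this, measure_empty]
  rw [h1, setLIntegral_indicator measurableSet_Ioc, Set.inter_eq_left.2 Set.Ioc_subset_Ioi_self,
    lintegral_mul_const _ (by fun_prop), ← ofReal_integral_eq_lintegral_ofReal,
    ← intervalIntegral.integral_of_le zero_le_one, intervalIntegral.integral_const_mul]
  · congr 3
    have hd : ∀ σ ∈ Set.uIcc (0 : ℝ) 1,
        HasDerivAt (fun σ => -(Real.exp (1 - t * σ) / t)) (Real.exp (1 - t * σ)) σ := by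
      intro σ _
      have h2 : HasDerivAt (fun σ : ℝ => 1 - t * σ) (-t) σ := by
        simpa using ((hasDerivAt_id σ).const_mul (t : ℝ)).const_sub 1
      refine (h2.exp.div_const (t : ℝ)).fun_neg.congr_deriv ?_
      field_simp
    rw [intervalIntegral.integral_eq_sub_of_hasDerivAt hd
      ((by fun_prop : Continuous fun σ : ℝ => Real.exp (1 - t * σ)).intervalIntegrable _ _)]
    rw [mul_one, mul_zero, sub_zero, sub_eq_add_neg (1 : ℝ) (t : ℝ), Real.exp_add]
    ring
  · exact (by fun_prop :
      Continuous fun σ : ℝ => R ^ (t * n) * Real.exp (1 - t * σ)).integrableOn_Ioc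
  · exact Eventually.of_forall fun σ => by positivity

end radial

end

/-! ### Images of the standard lattice -/

section

section
variable {K : Type*} [Field K] {t : ℕ}

/-- The image of the standard lattice under an `E`-linear map. -/
def imageLattice (Φ : (Fin t → mixedSpace K) →ₗ[mixedSpace K] (Fin t → mixedSpace K)) :
    Submodule (𝓞 K) (Fin t → mixedSpace K) :=
  LinearMap.range (Φ.restrictScalars (𝓞 K) ∘ₗ intEmb K t)

theorem mem_imageLattice {Φ : (Fin t → mixedSpace K) →ₗ[mixedSpace K] (Fin t → mixedSpace K)}
    {x : Fin t → mixedSpace K} : x ∈ imageLattice Φ ↔ ∃ y, Φ (intEmb K t y) = x := Iff.rfl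

variable (K) in
/-- The map that multiplies the `j`-th coordinate by the real number `c j`. -/
def diag (c : Fin t → ℝ) : (Fin t → mixedSpace K) →ₗ[mixedSpace K] (Fin t → mixedSpace K) where
  toFun x j := c j • x j
  map_add' x y := by
    funext j
    simp
  map_smul' a x := by
    funext j
    simp

/-- The determinant over `ℝ` of an `E`-linear endomorphism of `E ^ t`. -/
def realDet (Φ : (Fin t → mixedSpace K) →ₗ[mixedSpace K] (Fin t → mixedSpace K)) : ℝ :=
  LinearMap.det (Φ.restrictScalars ℝ)

theorem realDet_comp (Φ Ψ : (Fin t → mixedSpace K) →ₗ[mixedSpace K] (Fin t → mixedSpace K)) :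
    realDet (Φ ∘ₗ Ψ) = realDet Φ * realDet Ψ := by
  rw [realDet, LinearMap.restrictScalars_comp, LinearMap.det_comp]
  rfl

@[simp] theorem diag_apply (c : Fin t → ℝ) (x : Fin t → mixedSpace K) (j : Fin t) :
    diag K c x j = c j • x j := rfl
end

variable {K : Type*} [Field K] [NumberField K] {t : ℕ}

theorem realDet_diag (c : Fin t → ℝ) : realDet (diag K c) = ∏ j, c j ^ Module.finrank ℚ K := by
  have h : (diag K c).restrictScalars ℝ = LinearMap.pi fun j =>
      (c j • (LinearMap.id : mixedSpace K →ₗ[ℝ] mixedSpace K)) ∘ₗ LinearMap.proj j := by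
    ext x : 1
    rfl
  rw [realDet, h, LinearMap.det_pi]
  simp_rw [LinearMap.det_smul, LinearMap.det_id, mul_one, mixedEmbedding.finrank]

section image
variable {Φ : (Fin t → mixedSpace K) →ₗ[mixedSpace K] (Fin t → mixedSpace K)}

theorem injective_of_realDet_ne_zero (h : realDet Φ ≠ 0) : Function.Injective Φ :=
  (LinearMap.equivOfDetNeZero (Φ.restrictScalars ℝ) h).injective

theorem imageLattice_restrictScalars (h : realDet Φ ≠ 0) :
    (imageLattice Φ).restrictScalars ℤ = Submodule.span ℤ (Set.range
      ((intBasis K t).map (LinearMap.equivOfDetNeZero (Φ.restrictScalars ℝ) h))) := by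
  rw [← ZSpan.map]
  ext x
  simp only [Submodule.restrictScalars_mem, mem_imageLattice, Submodule.mem_map]
  constructor
  · rintro ⟨y, rfl⟩
    exact ⟨intEmb K t y, mem_span_intBasis.2 ⟨y, rfl⟩, rfl⟩
  · rintro ⟨z, hz, rfl⟩
    obtain ⟨y, rfl⟩ := mem_span_intBasis.1 hz
    exact ⟨y, rfl⟩

theorem isLattice_imageLattice (h : realDet Φ ≠ 0) : IsLattice (imageLattice Φ) := by
  have hinj : Function.Injective (Φ.restrictScalars (𝓞 K) ∘ₗ intEmb K t) :=
    (injective_of_realDet_ne_zero h).comp (intEmb_injective t)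
  let e : (Fin t → 𝓞 K) ≃ₗ[𝓞 K] imageLattice Φ := LinearEquiv.ofInjective _ hinj
  refine ⟨Module.Free.of_equiv e, ?_, ?_, ?_⟩
  · rw [← e.finrank_eq, Module.finrank_fin_fun]
  · have h1 : DiscreteTopology ((imageLattice Φ).restrictScalars ℤ) := by
      rw [imageLattice_restrictScalars h]
      infer_instance
    exact h1
  · have h1 : (imageLattice Φ : Set (Fin t → mixedSpace K)) =
        ((imageLattice Φ).restrictScalars ℤ : Set (Fin t → mixedSpace K)) := rfl
    rw [h1, imageLattice_restrictScalars h]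
    exact ZSpan.span_top _

theorem covolume_imageLattice (h : realDet Φ ≠ 0) :
    ZLattice.covolume ((imageLattice Φ).restrictScalars ℤ) volume =
      |realDet Φ| * (volume (ZSpan.fundamentalDomain (latticeBasis K))).toReal ^ t := by
  rw [imageLattice_restrictScalars h, ZLattice.covolume_eq_measure_fundamentalDomain _ _
    (ZSpan.isAddFundamentalDomain _ volume), ← ZSpan.map_fundamentalDomain, measureReal_def]
  have h1 := Measure.addHaar_image_linearMap volume (Φ.restrictScalars ℝ)
    (ZSpan.fundamentalDomain (intBasis K t))
  rw [volume_fundamentalDomain_intBasis] at h1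
  have h2 := congr_arg ENNReal.toReal h1
  rw [ENNReal.toReal_mul, ENNReal.toReal_ofReal (abs_nonneg _), ENNReal.toReal_pow] at h2
  exact h2

/-- An isometry maps the unit ball onto itself, so it preserves volumes. -/
theorem abs_realDet_eq_one (h : ∀ x, euclNorm (Φ x) = euclNorm x) : |realDet Φ| = 1 := by
  have hinj : Function.Injective Φ := by
    refine (injective_iff_map_eq_zero Φ).2 fun x hx => ?_
    by_contra hne
    have h1 := euclNorm_pos hne
    have h2 : euclNorm (0 : Fin t → mixedSpace K) = 0 := by
      simpa using euclNorm_smul (0 : ℝ) (0 : Fin t → mixedSpace K)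
    rw [← h, hx, h2] at h1
    exact lt_irrefl _ h1
  have hsurj : Function.Surjective Φ :=
    LinearMap.surjective_of_injective (f := Φ.restrictScalars ℝ) hinj
  have h1 := Measure.addHaar_image_linearMap volume (Φ.restrictScalars ℝ)
    {x : Fin t → mixedSpace K | euclNorm x ≤ 1}
  have h2 : Φ.restrictScalars ℝ '' {x : Fin t → mixedSpace K | euclNorm x ≤ 1} =
      {x | euclNorm x ≤ 1} := by
    ext x
    constructor
    · rintro ⟨z, hz, rfl⟩
      exact (h z).trans_le hz
    · intro hx
      obtain ⟨z, rfl⟩ := hsurj x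
      exact ⟨z, (h z).symm.trans_le hx, rfl⟩
  rw [h2] at h1
  have h3 := congr_arg ENNReal.toReal h1
  rw [ENNReal.toReal_mul, ENNReal.toReal_ofReal (abs_nonneg _)] at h3
  exact mul_right_cancel₀ (ENNReal.toReal_pos (volume_euclBall_ne_zero K t)
    (volume_euclBall_ne_top 1)).ne' (h3.symm.trans (one_mul _).symm)

end image

/-- The determinant of the unipotent part is obtained from the fact that it is conjugate to its own
square, by a diagonal map. -/
theorem realDet_shear {s : ℕ} {η ε : ℝ} (α : Fin s → mixedSpace K) :
    realDet (shear η ε α) = (η * ε ^ s) ^ Module.finrank ℚ K := by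
  have h2 : ∀ (η ε : ℝ) (α : Fin s → mixedSpace K),
      shear η ε α = diag K (Fin.cons η fun _ => ε) ∘ₗ shear 1 1 α := by
    intro η ε α
    refine LinearMap.ext fun x => funext fun j => ?_
    refine Fin.cases ?_ (fun j => ?_) j
    · simp
    · simp
  have h3 : ∀ α : Fin s → mixedSpace K, realDet (shear 1 1 α) = 1 := by
    intro α
    have h4 : shear 1 1 ((2 : ℝ) • α) = shear 1 1 α ∘ₗ shear 1 1 α := by
      refine LinearMap.ext fun x => funext fun j => ?_
      refine Fin.cases ?_ (fun j => ?_) j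
      · simp
      · simp [two_smul, mul_add, add_assoc]
    have h5 : diag K (Fin.cons 1 fun _ => (2 : ℝ)) ∘ₗ shear 1 1 α =
        shear 1 1 ((2 : ℝ) • α) ∘ₗ diag K (Fin.cons 1 fun _ => (2 : ℝ)) := by
      refine LinearMap.ext fun x => funext fun j => ?_
      refine Fin.cases ?_ (fun j => ?_) j
      · simp
      · simp
    have h6 := congr_arg realDet h5
    have h7 : realDet (diag K (Fin.cons 1 fun _ : Fin s => (2 : ℝ))) ≠ 0 := by
      rw [realDet_diag, Fin.prod_univ_succ]
      simp
    have h8 : realDet (shear 1 1 α) ≠ 0 := by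
      have h9 : Function.Injective (shear 1 1 α) := by
        refine (injective_iff_map_eq_zero _).2 fun x hx => ?_
        have h0 : x 0 = 0 := by simpa using congr_fun hx 0
        funext j
        refine Fin.cases h0 (fun j => ?_) j
        simpa [h0] using congr_fun hx j.succ
      exact (LinearEquiv.isUnit_det'
        (LinearEquiv.ofInjectiveEndo ((shear 1 1 α).restrictScalars ℝ) h9)).ne_zero
    rw [realDet_comp, realDet_comp, h4, realDet_comp, mul_comm] at h6
    have h10 := mul_right_cancel₀ h7 h6
    exact (mul_eq_left₀ h8).1 h10.symm
  rw [h2, realDet_comp, h3, mul_one, realDet_diag, Fin.prod_univ_succ]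
  simp [mul_pow, pow_right_comm]

/-- Orthogonal triangularization over `E`: Gram–Schmidt orthonormalization at every infinite place
yields an `E`-linear isometry `U` for which the vectors `U (v i)` are triangular. No independence of
the vectors `v i` is needed. -/
theorem exists_isometry_triangular (v : Fin t → (Fin t → mixedSpace K)) :
    ∃ U : (Fin t → mixedSpace K) →ₗ[mixedSpace K] (Fin t → mixedSpace K),
      (∀ x, euclNorm (U x) = euclNorm x) ∧ ∀ i j, i < j → U (v i) j = 0 := by
  let bR : ∀ w : {w : InfinitePlace K // w.IsReal},
      OrthonormalBasis (Fin t) ℝ (EuclideanSpace ℝ (Fin t)) := fun w =>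
    InnerProductSpace.gramSchmidtOrthonormalBasis (by simp)
      fun i => WithLp.toLp 2 fun k => (v i k).1 w
  let bC : ∀ w : {w : InfinitePlace K // w.IsComplex},
      OrthonormalBasis (Fin t) ℂ (EuclideanSpace ℂ (Fin t)) := fun w =>
    InnerProductSpace.gramSchmidtOrthonormalBasis (by simp)
      fun i => WithLp.toLp 2 fun k => (v i k).2 w
  let U : (Fin t → mixedSpace K) →ₗ[mixedSpace K] (Fin t → mixedSpace K) :=
    { toFun := fun x j => (fun w => (bR w).repr (WithLp.toLp 2 fun k => (x k).1 w) j,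
        fun w => (bC w).repr (WithLp.toLp 2 fun k => (x k).2 w) j)
      map_add' := fun x y => by
        funext j
        refine Prod.ext (funext fun w => ?_) (funext fun w => ?_)
        · exact congr_fun (congr_arg WithLp.ofLp ((bR w).repr.map_add
            (WithLp.toLp 2 fun k => (x k).1 w)
            (WithLp.toLp 2 fun k => (y k).1 w))) j
        · exact congr_fun (congr_arg WithLp.ofLp ((bC w).repr.map_add
            (WithLp.toLp 2 fun k => (x k).2 w)
            (WithLp.toLp 2 fun k => (y k).2 w))) j
      map_smul' := fun a x => by
        funext j
        refine Prod.ext (funext fun w => ?_) (funext fun w => ?_)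
        · exact congr_fun (congr_arg WithLp.ofLp ((bR w).repr.map_smul (a.1 w)
            (WithLp.toLp 2 fun k => (x k).1 w))) j
        · exact congr_fun (congr_arg WithLp.ofLp ((bC w).repr.map_smul (a.2 w)
            (WithLp.toLp 2 fun k => (x k).2 w))) j }
  refine ⟨U, fun x => euclNorm_eq_of_normAtPlace fun w => ?_, fun i j hij => ?_⟩
  · rcases w.isReal_or_isComplex with hw | hw
    · have h1 := (bR ⟨w, hw⟩).repr.norm_map (WithLp.toLp 2 fun k => (x k).1 ⟨w, hw⟩)
      have h2 := congr_arg (· ^ 2) h1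
      simp only [EuclideanSpace.norm_sq_eq] at h2
      simp only [normAtPlace_apply_of_isReal hw]
      exact h2
    · have h1 := (bC ⟨w, hw⟩).repr.norm_map (WithLp.toLp 2 fun k => (x k).2 ⟨w, hw⟩)
      have h2 := congr_arg (· ^ 2) h1
      simp only [EuclideanSpace.norm_sq_eq] at h2
      simp only [normAtPlace_apply_of_isComplex hw]
      exact h2
  · refine Prod.ext (funext fun w => ?_) (funext fun w => ?_)
    · exact InnerProductSpace.gramSchmidtOrthonormalBasis_inv_triangular' _ _ hij
    · exact InnerProductSpace.gramSchmidtOrthonormalBasis_inv_triangular' _ _ hij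

end

/-! ### Successive minima -/

section

variable {K : Type*} [Field K] {t : ℕ}

/-- Vectors that realize the successive minima over `K` of a function `ν` with finite sublevel sets,
chosen greedily: `y k` minimizes `ν` among the integral vectors outside the span `P k` of its
predecessors. The sequence `y` is indexed by `ℕ`; only its terms below `t` matter. -/
theorem exists_successive_minima (ν : (Fin t → 𝓞 K) → ℝ) (hν : ∀ c, {y | ν y ≤ c}.Finite) :
    ∃ (P : ℕ → Submodule K (Fin t → K)) (y : ℕ → Fin t → 𝓞 K), P 0 = ⊥ ∧ P t = ⊤ ∧
      (∀ k, P (k + 1) = P k ⊔ Submodule.span K {fun j => (y k j : K)}) ∧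
      ∀ k < t, (fun j => (y k j : K)) ∉ P k ∧
        ∀ x : Fin t → 𝓞 K, (fun j => (x j : K)) ∉ P k → ν (y k) ≤ ν x := by
  have hex : ∀ P : Submodule K (Fin t → K), ∃ y : Fin t → 𝓞 K, P ≠ ⊤ →
      (fun j => (y j : K)) ∉ P ∧
        ∀ x : Fin t → 𝓞 K, (fun j => (x j : K)) ∉ P → ν y ≤ ν x := by
    intro P
    by_cases hP : P = ⊤
    · exact ⟨0, fun h => absurd hP h⟩
    obtain ⟨x₀, hx₀⟩ : ∃ x : Fin t → 𝓞 K, (fun j => (x j : K)) ∉ P := by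
      by_contra! h
      refine hP (top_le_iff.1 ?_)
      rw [← (Pi.basisFun K (Fin t)).span_eq, Submodule.span_le]
      rintro _ ⟨i, rfl⟩
      have h1 : Pi.basisFun K (Fin t) i =
          fun j => ((Pi.single i 1 : Fin t → 𝓞 K) j : K) := ?_
      · rw [h1]
        exact h _
      funext j
      by_cases hij : j = i
      · subst hij
        simp
      · simp [hij]
    obtain ⟨y, hy, hmin⟩ := Set.exists_min_image
      ({y | ν y ≤ ν x₀} ∩ {y | (fun j => (y j : K)) ∉ P}) ν ((hν _).inter_of_left _)
      ⟨x₀, show ν x₀ ≤ ν x₀ from le_rfl, hx₀⟩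
    refine ⟨y, fun _ => ⟨hy.2, fun x hx => ?_⟩⟩
    by_cases h : ν x ≤ ν x₀
    · exact hmin x ⟨h, hx⟩
    · exact hy.1.trans (not_le.1 h).le
  choose g hg using hex
  let P : ℕ → Submodule K (Fin t → K) := fun k =>
    Nat.rec (motive := fun _ => Submodule K (Fin t → K)) ⊥
      (fun _ P => P ⊔ Submodule.span K {fun j => (g P j : K)}) k
  have hP : ∀ k, P (k + 1) = P k ⊔ Submodule.span K {fun j => (g (P k) j : K)} := fun _ => rfl
  have hle : ∀ k : ℕ, Module.finrank K (P k) ≤ k := by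
    intro k
    induction k with
    | zero => simp [P]
    | succ k ih =>
      rw [hP]
      exact (Submodule.finrank_add_le_finrank_add_finrank _ _).trans
        (Nat.add_le_add ih ((finrank_span_le_card _).trans (by simp)))
  have hne : ∀ k < t, P k ≠ ⊤ := by
    intro k hk h
    have := hle k
    rw [h, finrank_top, Module.finrank_fin_fun] at this
    omega
  -- the spans grow strictly up to the step `t`, so the last one is everything
  have hge : ∀ k ≤ t, k ≤ Module.finrank K (P k) := by
    intro k
    induction k with
    | zero => simp
    | succ k ih =>
      intro hk
      refine Nat.succ_le_of_lt ((ih (by omega)).trans_lt (Submodule.finrank_lt_finrank_of_lt ?_))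
      refine lt_of_le_of_ne (by rw [hP]; exact le_sup_left) fun h => (hg _ (hne k hk)).1 ?_
      have h1 : (fun j => (g (P k) j : K)) ∈ P (k + 1) := by
        rw [hP]
        exact Submodule.mem_sup_right (Submodule.mem_span_singleton_self _)
      rwa [← h] at h1
  refine ⟨P, fun k => g (P k), rfl, ?_, hP, fun k hk => hg _ (hne k hk)⟩
  refine Submodule.eq_top_of_finrank_eq (le_antisymm ?_ ?_)
  · exact Submodule.finrank_le _
  · rw [Module.finrank_fin_fun]
    exact hge t le_rfl

/-- A triangularity condition on the `y i` passes to the spans `P k`: the last `t - k` coordinates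
of `Ψ` vanish on `P k`. -/
theorem map_mixedEmbedding_eq_zero
    {Ψ : (Fin t → mixedSpace K) →ₗ[mixedSpace K] (Fin t → mixedSpace K)}
    {P : ℕ → Submodule K (Fin t → K)} {y : ℕ → Fin t → 𝓞 K} (h0 : P 0 = ⊥)
    (hP : ∀ k, P (k + 1) = P k ⊔ Submodule.span K {fun j => (y k j : K)})
    (hΨ : ∀ i j : Fin t, i < j → Ψ (intEmb K t (y i)) j = 0) {k : ℕ} {z : Fin t → K}
    (hz : z ∈ P k) {j : Fin t} (hj : k ≤ j) : Ψ (fun i => mixedEmbedding K (z i)) j = 0 := by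
  induction k generalizing z with
  | zero =>
    rw [h0, Submodule.mem_bot] at hz
    have : (fun i => mixedEmbedding K (z i)) = 0 := by
      funext i
      simp [hz]
    rw [this, map_zero, Pi.zero_apply]
  | succ k ih =>
    rw [hP, Submodule.mem_sup] at hz
    obtain ⟨a, ha, b, hb, rfl⟩ := hz
    obtain ⟨c, rfl⟩ := Submodule.mem_span_singleton.1 hb
    have h1 : (fun i => mixedEmbedding K ((a + c • fun j => (y k j : K)) i)) =
        (fun i => mixedEmbedding K (a i)) + mixedEmbedding K c • intEmb K t (y k) := by
      funext i
      simp
    rw [h1, map_add, map_smul, Pi.add_apply, Pi.smul_apply, ih ha (by omega),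
      hΨ ⟨k, by omega⟩ j (by rw [Fin.lt_def]; exact hj), smul_zero, add_zero]

variable [NumberField K]

theorem euclNorm_mono {x y : Fin t → mixedSpace K}
    (h : ∀ j w, normAtPlace w (x j) ≤ normAtPlace w (y j)) : euclNorm x ≤ euclNorm y := by
  refine Real.sqrt_le_sqrt (Finset.sum_le_sum fun j _ => Finset.sum_le_sum fun w _ => ?_)
  have := h j w
  have := normAtPlace_nonneg w (x j)
  gcongr

theorem finite_euclNorm_le {Φ : (Fin t → mixedSpace K) →ₗ[mixedSpace K] (Fin t → mixedSpace K)}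
    (hΦ : realDet Φ ≠ 0) (c : ℝ) : {y | euclNorm (Φ (intEmb K t y)) ≤ c}.Finite := by
  have h1 := ZSpan.setFinite_inter
    ((intBasis K t).map (LinearMap.equivOfDetNeZero (Φ.restrictScalars ℝ) hΦ))
    (Metric.isBounded_closedBall (x := 0) (r := c))
  rw [← imageLattice_restrictScalars hΦ] at h1
  refine Set.Finite.of_finite_image (f := fun y => Φ (intEmb K t y)) (h1.subset ?_)
    ((injective_of_realDet_ne_zero hΦ).comp (intEmb_injective t)).injOn
  rintro _ ⟨y, hy, rfl⟩
  exact ⟨mem_closedBall_zero_iff.2 ((norm_le_euclNorm _).trans hy), ⟨y, rfl⟩⟩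

theorem euclNorm_map_torsion
    (Φ : (Fin t → mixedSpace K) →ₗ[mixedSpace K] (Fin t → mixedSpace K))
    (u : Units.torsion K) (y : Fin t → 𝓞 K) :
    euclNorm (Φ (intEmb K t (((u : (𝓞 K)ˣ) : 𝓞 K) • y))) = euclNorm (Φ (intEmb K t y)) := by
  have h1 : Φ (intEmb K t (((u : (𝓞 K)ˣ) : 𝓞 K) • y)) =
      mixedEmbedding K (((u : (𝓞 K)ˣ) : 𝓞 K) : K) • Φ (intEmb K t y) := by
    rw [← map_smul]
    congr 1
    funext j
    simp
  rw [h1]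
  refine euclNorm_eq_of_normAtPlace fun w => Finset.sum_congr rfl fun j _ => ?_
  rw [Pi.smul_apply, smul_eq_mul, map_mul, normAtPlace_apply,
    (Units.mem_torsion K).1 u.2 w, one_mul]

/-- The vectors that realize the successive minima and their multiples by roots of unity are
distinct and survive the sieve, since dividing one of them by a prime would give a shorter vector
outside the same span. -/
theorem torsionOrder_mul_sum_le {Q : Finset ℕ} (hQ : ∀ q ∈ Q, q.Prime)
    {Φ : (Fin t → mixedSpace K) →ₗ[mixedSpace K] (Fin t → mixedSpace K)}
    (hΦ : realDet Φ ≠ 0)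
    {P : ℕ → Submodule K (Fin t → K)} {y : ℕ → Fin t → 𝓞 K}
    (hP : ∀ k, P (k + 1) = P k ⊔ Submodule.span K {fun j => (y k j : K)})
    (hy : ∀ k < t, (fun j => (y k j : K)) ∉ P k ∧
        ∀ x : Fin t → 𝓞 K, (fun j => (x j : K)) ∉ P k →
          euclNorm (Φ (intEmb K t (y k))) ≤ euclNorm (Φ (intEmb K t x)))
    (g : ℝ → ℝ≥0∞) :
    Units.torsionOrder K * ∑ k : Fin t, g (euclNorm (Φ (intEmb K t (y k)))) ≤
      ∑' x, (sieved K t Q).indicator (fun x => g (euclNorm (Φ (intEmb K t x)))) x := by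
  have hmono : Monotone P := monotone_nat_of_le_succ fun k => by
    rw [hP]
    exact le_sup_left
  have hmem : ∀ k, (fun j => (y k j : K)) ∈ P (k + 1) := fun k => by
    rw [hP]
    exact Submodule.mem_sup_right (Submodule.mem_span_singleton_self _)
  have hsmul : ∀ (u : Units.torsion K) (k l : ℕ),
      (fun j => (((((u : (𝓞 K)ˣ) : 𝓞 K) • y k) j : 𝓞 K) : K)) ∈ P l ↔
        (fun j => (y k j : K)) ∈ P l := by
    intro u k l
    have : (fun j => (((((u : (𝓞 K)ˣ) : 𝓞 K) • y k) j : 𝓞 K) : K)) =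
        (((u : (𝓞 K)ˣ) : 𝓞 K) : K) • fun j => (y k j : K) := by
      funext j
      simp
    rw [this, Submodule.smul_mem_iff _ (by simp)]
  have hinj : Function.Injective fun a : Units.torsion K × Fin t =>
      ((a.1 : (𝓞 K)ˣ) : 𝓞 K) • y a.2 := by
    rintro ⟨u, k⟩ ⟨v, l⟩ h
    simp only at h
    have hkl : ∀ (u v : Units.torsion K) (k l : Fin t),
        ((u : (𝓞 K)ˣ) : 𝓞 K) • y k = ((v : (𝓞 K)ˣ) : 𝓞 K) • y l → l ≤ k := by
      intro u v k l h
      by_contra! hlt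
      have h1 := (hsmul u k (k + 1)).2 (hmem k)
      rw [h, hsmul] at h1
      exact (hy l l.2).1 (hmono (by rw [Fin.lt_def] at hlt; omega) h1)
    obtain rfl : k = l := le_antisymm (hkl v u l k h.symm) (hkl u v k l h)
    have hne : y k ≠ 0 := fun h0 => (hy k k.2).1 (by
      rw [h0]
      exact (P k).zero_mem)
    obtain ⟨j, hj⟩ := Function.ne_iff.1 hne
    have h1 := mul_right_cancel₀ hj (congr_fun h j)
    exact Prod.ext (Subtype.ext (Units.ext h1)) rfl
  have hsieve : ∀ a : Units.torsion K × Fin t,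
      ((a.1 : (𝓞 K)ˣ) : 𝓞 K) • y a.2 ∈ sieved K t Q := by
    rintro ⟨u, k⟩
    have hnot : (fun j => (((((u : (𝓞 K)ˣ) : 𝓞 K) • y k) j : 𝓞 K) : K)) ∉ P k := fun h =>
      (hy k k.2).1 ((hsmul u k k).1 h)
    have hne : ((u : (𝓞 K)ˣ) : 𝓞 K) • y k ≠ 0 := fun h0 => hnot (by
      rw [h0]
      exact (P k).zero_mem)
    refine ⟨hne, fun p hp z hz => ?_⟩
    simp only at hz
    have hzP : (fun j => (z j : K)) ∉ P k := fun h => hnot (by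
      rw [hz]
      have : (fun j => (((p • z) j : 𝓞 K) : K)) = (p : K) • fun j => (z j : K) := by
        funext j
        simp
      rw [this]
      exact (P k).smul_mem _ h)
    have h1 := (hy k k.2).2 z hzP
    have h2 := euclNorm_map_torsion Φ u (y k)
    rw [hz, map_nsmul, map_nsmul, ← Nat.cast_smul_eq_nsmul ℝ, euclNorm_smul, Nat.abs_cast] at h2
    rw [← h2] at h1
    have h3 : (2 : ℝ) ≤ p := by exact_mod_cast (hQ p hp).two_le
    have h4 : 0 < euclNorm (Φ (intEmb K t z)) := by
      refine euclNorm_pos fun h0 => hne ?_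
      rw [hz, intEmb_injective t (injective_of_realDet_ne_zero hΦ (h0.trans (by simp)) :
        intEmb K t z = intEmb K t 0), smul_zero]
    nlinarith
  refine le_trans (le_of_eq ?_) (ENNReal.tsum_comp_le_tsum_of_injective hinj _)
  simp_rw [Set.indicator_of_mem (hsieve _), euclNorm_map_torsion]
  have := Fintype.ofFinite (Units.torsion K)
  rw [tsum_fintype, Fintype.sum_prod_type]
  simp only
  rw [Finset.sum_const, nsmul_eq_mul, Finset.card_univ,
    Units.torsionOrder, Nat.card_eq_fintype_card]

/-- If the sum of the cut-off function over the sieved vectors of a unimodular image of the standard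
lattice is less than the number of roots of unity, the product of the successive minima is at least
`R ^ t`, and rescaling along an orthogonal flag gives a lattice at least as dense as one of
first minimum `R` and the same covolume. -/
theorem exists_isLattice_packingDensity_ge (ht : 0 < t) {Q : Finset ℕ} (hQ : ∀ q ∈ Q, q.Prime)
    {Φ : (Fin t → mixedSpace K) →ₗ[mixedSpace K] (Fin t → mixedSpace K)}
    (hΦ : |realDet Φ| = 1) {R : ℝ} (hR : 0 < R)
    (hsum : ∑' x, (sieved K t Q).indicator (fun x => ENNReal.ofReal
      (radial t (Module.finrank ℚ K) R (euclNorm (Φ (intEmb K t x))))) x < Units.torsionOrder K) :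
    ∃ Λ : Submodule (𝓞 K) (Fin t → mixedSpace K), IsLattice Λ ∧
      (R / 2) ^ (t * Module.finrank ℚ K) *
        (volume {x : Fin t → mixedSpace K | euclNorm x ≤ 1}).toReal /
          (volume (ZSpan.fundamentalDomain (latticeBasis K))).toReal ^ t ≤ packingDensity Λ := by
  have hn : 0 < Module.finrank ℚ K := Module.finrank_pos
  set n := Module.finrank ℚ K with hn_def
  have hΦ0 : realDet Φ ≠ 0 := fun h => by simp [h] at hΦ
  obtain ⟨P, y, hP0, hPt, hP, hy⟩ := exists_successive_minima
    (fun y => euclNorm (Φ (intEmb K t y))) (finite_euclNorm_le hΦ0)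
  set lam : Fin t → ℝ := fun k => euclNorm (Φ (intEmb K t (y k))) with hlam_def
  have hinj := (injective_of_realDet_ne_zero hΦ0).comp (intEmb_injective t)
  have hlam : ∀ k, 0 < lam k := fun k => euclNorm_pos fun h => (hy k k.2).1 (by
    rw [hinj (h.trans (by simp) : _ = (Φ ∘ intEmb K t) 0)]
    exact (P k).zero_mem)
  have hmono : Monotone P := monotone_nat_of_le_succ fun k => by
    rw [hP]
    exact le_sup_left
  -- the product of the successive minima is large
  have hprod : R ^ t ≤ ∏ k, lam k := by
    have h1 := (torsionOrder_mul_sum_le hQ hΦ0 hP hy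
      fun ρ => ENNReal.ofReal (radial t n R ρ)).trans_lt hsum
    have h2 : ∑ k, radial t n R (lam k) < 1 := by
      rw [← ENNReal.ofReal_sum_of_nonneg fun k _ => radial_nonneg _] at h1
      by_contra! h3
      refine h1.not_ge (le_mul_of_one_le_right zero_le ?_)
      exact ENNReal.one_le_ofReal.2 h3
    have h3 : ∀ k, (t : ℝ)⁻¹ - n * Real.log (lam k / R) ≤ radial t n R (lam k) := fun k =>
      sub_log_le_radial hR ((Finset.single_le_sum (f := fun k => radial t n R (lam k))
        (fun k _ => radial_nonneg _) (Finset.mem_univ k)).trans_lt h2) hn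
    have h4 := (Finset.sum_le_sum fun k (_ : k ∈ Finset.univ) => h3 k).trans_lt h2
    rw [Finset.sum_sub_distrib, Finset.sum_const, Finset.card_univ, Fintype.card_fin, nsmul_eq_mul,
      mul_inv_cancel₀ (by positivity), ← Finset.mul_sum,
      ← Real.log_prod fun k _ => (div_pos (hlam k) hR).ne'] at h4
    have h5 : 0 < Real.log (∏ k, lam k / R) := by
      have hn' : (0 : ℝ) < n := by exact_mod_cast hn
      by_contra! h
      nlinarith
    rw [Real.log_pos_iff (Finset.prod_nonneg fun k _ => (div_pos (hlam k) hR).le),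
      Finset.prod_div_distrib, Finset.prod_const, Finset.card_univ, Fintype.card_fin,
      one_lt_div (by positivity)] at h5
    exact h5.le
  obtain ⟨U, hU, hUtri⟩ := exists_isometry_triangular fun k : Fin t => Φ (intEmb K t (y k))
  set T := diag K (fun k => (lam k)⁻¹) ∘ₗ (U ∘ₗ Φ) with hT
  have hdet : |realDet T| = ((∏ k, lam k) ^ n)⁻¹ := by
    rw [hT, realDet_comp, realDet_comp, abs_mul, abs_mul, hΦ, abs_realDet_eq_one hU, realDet_diag,
      Finset.prod_pow, Finset.prod_inv_distrib, mul_one, mul_one, inv_pow,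
      abs_of_pos (inv_pos.2 (pow_pos (Finset.prod_pos fun k _ => hlam k) n))]
  have hdet0 : realDet T ≠ 0 := by
    rw [← abs_pos, hdet]
    exact inv_pos.2 (pow_pos (Finset.prod_pos fun k _ => hlam k) n)
  refine ⟨imageLattice T, isLattice_imageLattice hdet0, ?_⟩
  -- all nonzero vectors of the new lattice have norm at least `1`
  have hmin : ∀ x : Fin t → 𝓞 K, x ≠ 0 → 1 ≤ euclNorm (T (intEmb K t x)) := by
    intro x hx
    -- `x` lies in the span of the first `k + 1` vectors, but not in that of the first `k`
    have hex : ∃ k, (fun j => (x j : K)) ∈ P k := ⟨t, by rw [hPt]; trivial⟩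
    obtain ⟨k, hk⟩ : ∃ k, Nat.find hex = k + 1 := by
      refine Nat.exists_eq_succ_of_ne_zero fun h => hx ?_
      have h1 := Nat.find_spec hex
      rw [h, hP0, Submodule.mem_bot] at h1
      funext j
      simpa using congr_fun h1 j
    have hxk : (fun j => (x j : K)) ∈ P (k + 1) := hk ▸ Nat.find_spec hex
    have hxk' : (fun j => (x j : K)) ∉ P k := Nat.find_min hex (by omega)
    have hkt : k < t := by
      have : Nat.find hex ≤ t := Nat.find_min' hex (by rw [hPt]; trivial)
      omega
    have hzero : ∀ j : Fin t, k + 1 ≤ j → U (Φ (intEmb K t x)) j = 0 := fun j hj =>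
      map_mixedEmbedding_eq_zero (Ψ := U ∘ₗ Φ) hP0 hP (fun i j hij => hUtri i j hij) hxk hj
    have h1 : lam ⟨k, hkt⟩ ≤ euclNorm (U (Φ (intEmb K t x))) := by
      rw [hU]
      exact (hy k hkt).2 x hxk'
    calc (1 : ℝ) ≤ (lam ⟨k, hkt⟩)⁻¹ * euclNorm (U (Φ (intEmb K t x))) := by
          rwa [← div_eq_inv_mul, one_le_div (hlam _)]
      _ = euclNorm ((lam ⟨k, hkt⟩)⁻¹ • U (Φ (intEmb K t x))) := by
          rw [euclNorm_smul, abs_of_pos (inv_pos.2 (hlam _))]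
      _ ≤ euclNorm (T (intEmb K t x)) := by
          refine euclNorm_mono fun j w => ?_
          rw [hT, LinearMap.comp_apply, LinearMap.comp_apply, diag_apply, Pi.smul_apply,
            normAtPlace_smul, normAtPlace_smul, abs_of_pos (inv_pos.2 (hlam _)),
            abs_of_pos (inv_pos.2 (hlam _))]
          by_cases hj : k + 1 ≤ j
          · simp [hzero j hj]
          · refine mul_le_mul_of_nonneg_right ?_ (normAtPlace_nonneg _ _)
            refine inv_anti₀ (hlam j) ((hy j j.2).2 (y k) fun h => ?_)
            exact (hy k hkt).1 (hmono (by omega) h)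
  have hfirst : 1 ≤ firstMin (imageLattice T) := by
    refine le_csInf ?_ ?_
    · refine ⟨_, T (intEmb K t (y 0)), ⟨⟨y 0, rfl⟩, fun h => ?_⟩, rfl⟩
      have h1 : intEmb K t (y 0) = 0 := injective_of_realDet_ne_zero hdet0 (h.trans (by simp))
      have h2 := hlam ⟨0, ht⟩
      rw [hlam_def] at h2
      simp only [h1, map_zero] at h2
      have h3 := euclNorm_smul (0 : ℝ) (0 : Fin t → mixedSpace K)
      simp only [smul_zero, abs_zero, zero_mul] at h3
      exact h2.ne' h3
    · rintro _ ⟨_, ⟨⟨x, rfl⟩, hx⟩, rfl⟩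
      refine hmin x fun h => hx ?_
      rw [h, map_zero]
  set V := (volume {x : Fin t → mixedSpace K | euclNorm x ≤ 1}).toReal with hV
  have hvol : (1 / 2) ^ (t * n) * V ≤
      (volume {x : Fin t → mixedSpace K | euclNorm x ≤ firstMin (imageLattice T) / 2}).toReal := by
    have h1 : volume {x : Fin t → mixedSpace K | euclNorm x ≤ 1 / 2} ≤
        volume {x : Fin t → mixedSpace K | euclNorm x ≤ firstMin (imageLattice T) / 2} :=
      measure_mono fun x (hx : euclNorm x ≤ 1 / 2) =>
        (show euclNorm x ≤ firstMin (imageLattice T) / 2 by linarith)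
    have h2 := ENNReal.toReal_mono (volume_euclBall_ne_top _) h1
    rwa [volume_euclBall (by norm_num), ENNReal.toReal_mul,
      ENNReal.toReal_ofReal (by positivity)] at h2
  have hc : 0 < (volume (ZSpan.fundamentalDomain (latticeBasis K))).toReal :=
    ENNReal.toReal_pos (ZSpan.measure_fundamentalDomain_ne_zero _)
      (ZSpan.fundamentalDomain_isBounded _).measure_lt_top.ne
  rw [packingDensity, covolume_imageLattice hdet0, hdet]
  have hpos : 0 < (∏ k, lam k) ^ n := pow_pos (Finset.prod_pos fun k _ => hlam k) n
  rw [inv_mul_eq_div, div_div_eq_mul_div]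
  refine div_le_div_of_nonneg_right ?_ (by positivity)
  calc (R / 2) ^ (t * n) * V = ((1 / 2) ^ (t * n) * V) * (R ^ t) ^ n := by
        rw [div_eq_mul_one_div, mul_pow, ← pow_mul]
        ring
    _ ≤ _ := mul_le_mul hvol (by gcongr) (by positivity) ENNReal.toReal_nonneg

end

/-! ### Existence of dense lattices -/

section

variable {K : Type*} [Field K] [NumberField K]

/-- Some member of the family of shears does not exceed the mean. -/
theorem exists_shear_tsum_lt {s : ℕ} (hs : s ≠ 0) {f : (Fin (s + 1) → mixedSpace K) → ℝ≥0}
    (hf : Continuous f) {B : ℝ} (hB : ∀ x, f x ≠ 0 → ‖x‖ ≤ B) {Q : Finset ℕ}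
    (hQ : ∀ q ∈ Q, q.Prime) {r : ℝ≥0∞}
    (hr : ENNReal.ofReal (∏ p ∈ Q, (1 - ((p : ℝ) ^ ((s + 1) * Module.finrank ℚ K))⁻¹)) *
        ∫⁻ x, f x < r * volume (ZSpan.fundamentalDomain (latticeBasis K)) ^ (s + 1)) :
    ∃ Φ : (Fin (s + 1) → mixedSpace K) →ₗ[mixedSpace K] (Fin (s + 1) → mixedSpace K),
      |realDet Φ| = 1 ∧
      ∑' y, (sieved K (s + 1) Q).indicator
        (fun y => (f (Φ (intEmb K (s + 1) y)) : ℝ≥0∞)) y < r := by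
  obtain ⟨q, hq, hq0⟩ := (((tendsto_mean hs hf hB hQ).eventually_lt_const hr).and
    (eventually_gt_atTop 0)).exists
  have hq' : (0 : ℝ) < q := by exact_mod_cast hq0
  rw [pow_succ, ← mul_assoc] at hq
  have h1 := lt_of_mul_lt_mul_right' hq
  rw [← volume_fundamentalDomain_intBasis, ← setLIntegral_const] at h1
  obtain ⟨α, hα⟩ : ∃ α : Fin s → mixedSpace K, ∑' y, (sieved K (s + 1) Q).indicator
      (fun y => (f (shear (q : ℝ)⁻¹ ((q : ℝ) ^ (s : ℝ)⁻¹) α (intEmb K (s + 1) y)) : ℝ≥0∞)) y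
        < r := by
    by_contra! h
    exact h1.not_ge (lintegral_mono h)
  refine ⟨_, ?_, hα⟩
  have h2 : ((q : ℝ) ^ (s : ℝ)⁻¹) ^ s = q := by
    rw [← Real.rpow_natCast, ← Real.rpow_mul hq'.le, inv_mul_cancel₀ (by positivity),
      Real.rpow_one]
  rw [realDet_shear, h2, inv_mul_cancel₀ hq'.ne', one_pow, abs_one]

/-- The density bound with a factor `δ` in the open unit interval in place of `1 - ε`. -/
theorem exists_isLattice_packingDensity_ge_of_lt_one {s : ℕ} (hs : s ≠ 0) {δ : ℝ} (hδ : 0 < δ)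
    (hδ1 : δ < 1) :
    ∃ Λ : Submodule (𝓞 K) (Fin (s + 1) → mixedSpace K), IsLattice Λ ∧
      (Units.torsionOrder K : ℝ) * (s + 1 : ℕ) *
          (riemannZeta (((s + 1) * Module.finrank ℚ K : ℕ) : ℂ)).re * δ /
        (Real.exp 1 * (1 - Real.exp (-((s + 1 : ℕ) : ℝ))) * 2 ^ ((s + 1) * Module.finrank ℚ K)) ≤
      packingDensity Λ := by
  have hn : 0 < Module.finrank ℚ K := Module.finrank_pos
  have hr : (0 : ℝ) < Units.torsionOrder K := by exact_mod_cast Units.torsionOrder_pos K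
  set N := (s + 1) * Module.finrank ℚ K with hN_def
  have hN : 1 < N := by
    have : 2 ≤ s + 1 := by omega
    nlinarith
  set t : ℝ := ((s + 1 : ℕ) : ℝ) with ht_def
  have ht : 0 < t := by positivity
  set ζ := (riemannZeta (N : ℂ)).re with hζ_def
  have hζ : 0 < ζ := by
    exact_mod_cast riemannZeta_re_pos_of_one_lt (x := (N : ℝ)) (by exact_mod_cast hN)
  set A := Real.exp 1 * (1 - Real.exp (-t)) with hA_def
  have hA : 0 < A := mul_pos (Real.exp_pos _) (by simpa using ht)
  set V := (volume {x : Fin (s + 1) → mixedSpace K | euclNorm x ≤ 1}).toReal with hV_def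
  have hV : 0 < V :=
    ENNReal.toReal_pos (volume_euclBall_ne_zero K (s + 1)) (volume_euclBall_ne_top 1)
  set c := (volume (ZSpan.fundamentalDomain (latticeBasis K))).toReal with hc_def
  have hctop : volume (ZSpan.fundamentalDomain (latticeBasis K)) ≠ ∞ :=
    (ZSpan.fundamentalDomain_isBounded _).measure_lt_top.ne
  have hc : 0 < c := ENNReal.toReal_pos (ZSpan.measure_fundamentalDomain_ne_zero _) hctop
  -- the radius for which the integral of the cut-off is `δ ζ(N)` times the critical value
  obtain ⟨R, hR, hRN⟩ : ∃ R : ℝ, 0 < R ∧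
      R ^ N = Units.torsionOrder K * t * ζ * δ * c ^ (s + 1) / (A * V) := by
    have hX : 0 < Units.torsionOrder K * t * ζ * δ * c ^ (s + 1) / (A * V) := by positivity
    refine ⟨_, Real.rpow_pos_of_pos hX (N : ℝ)⁻¹, ?_⟩
    rw [← Real.rpow_natCast, ← Real.rpow_mul hX.le, inv_mul_cancel₀ (by positivity), Real.rpow_one]
  -- enough primes for the Euler product to be within a factor `1 / δ` of its limit
  obtain ⟨m, hm⟩ : ∃ m : ℕ, (∏ p ∈ m.primesBelow, (1 - ((p : ℝ) ^ N)⁻¹)) * (ζ * δ) < 1 := by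
    have h1 := (tendsto_prod_primesBelow hN).mul_const (ζ * δ)
    rw [← hζ_def, inv_mul_cancel_left₀ hζ.ne'] at h1
    exact (h1.eventually_lt_const hδ1).exists
  have hQ : ∀ q ∈ m.primesBelow, q.Prime := fun q => Nat.prime_of_mem_primesBelow
  have hP : 0 ≤ ∏ p ∈ m.primesBelow, (1 - ((p : ℝ) ^ N)⁻¹) := Finset.prod_nonneg fun q hq => by
    have : (1 : ℝ) ≤ (q : ℝ) ^ N := one_le_pow₀ (by exact_mod_cast (hQ q hq).one_le)
    linarith [inv_le_one_of_one_le₀ this]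
  obtain ⟨Φ, hΦ, hsum⟩ := exists_shear_tsum_lt (K := K) hs
    (f := fun x => (radial (s + 1) (Module.finrank ℚ K) R (euclNorm x)).toNNReal)
    (B := R * Real.exp (((s + 1 : ℕ) : ℝ)⁻¹ / Module.finrank ℚ K))
    (continuous_real_toNNReal.comp ((continuous_radial hR).comp continuous_euclNorm))
    (fun x hx => (norm_le_euclNorm x).trans (le_of_radial_ne_zero hn hR fun h => hx (by simp [h])))
    hQ (r := Units.torsionOrder K) (by
      have h1 := lintegral_radial (K := K) (t := s + 1) (R := R) (Nat.succ_pos s) hR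
      refine (congr_arg _ h1).trans_lt ?_
      rw [← ENNReal.ofReal_toReal (volume_euclBall_ne_top (K := K) (t := s + 1) 1),
        ← ENNReal.ofReal_toReal hctop, ← ENNReal.ofReal_natCast, ← ENNReal.ofReal_pow hc.le,
        ← ENNReal.ofReal_mul hr.le, ← ENNReal.ofReal_mul (by positivity),
        ← ENNReal.ofReal_mul hP, ENNReal.ofReal_lt_ofReal_iff (by positivity)]
      rw [← hN_def, ← hV_def, hRN, ← ht_def, ← hA_def]
      have h2 : Units.torsionOrder K * t * ζ * δ * c ^ (s + 1) / (A * V) * (A / t) * V =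
          (ζ * δ) * (Units.torsionOrder K * c ^ (s + 1)) := by
        field_simp
      rw [h2, ← mul_assoc]
      exact mul_lt_of_lt_one_left (by positivity) hm)
  obtain ⟨Λ, hΛ, hdens⟩ := exists_isLattice_packingDensity_ge (Nat.succ_pos s) hQ hΦ hR hsum
  refine ⟨Λ, hΛ, le_trans (le_of_eq ?_) hdens⟩
  rw [← hN_def, ← hV_def, ← hc_def, div_pow, hRN]
  field_simp

end

end OKLattice

end

theorem mainTheorem2 (K : Type*) [Field K] [NumberField K] (t : ℕ) (ht : 2 ≤ t)
    (ε : ℝ) (hε : 0 < ε) :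
    ∃ Λ : Submodule (𝓞 K) (Fin t → mixedSpace K),
      OKLattice.IsLattice Λ ∧
      (NumberField.Units.torsionOrder K : ℝ) * t *
          (riemannZeta ((t * Module.finrank ℚ K : ℕ) : ℂ)).re * (1 - ε) /
        (Real.exp 1 * (1 - Real.exp (-(t : ℝ))) * 2 ^ (t * Module.finrank ℚ K)) ≤
      OKLattice.packingDensity Λ := by
  obtain ⟨s, rfl⟩ : ∃ s, t = s + 1 := ⟨t - 1, by omega⟩
  have hδ : 0 < 1 - min ε (1 / 2) := by linarith [min_le_right ε (1 / 2)]
  have hδ1 : 1 - min ε (1 / 2) < 1 := by linarith [lt_min hε one_half_pos]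
  obtain ⟨Λ, hΛ, hdens⟩ := OKLattice.exists_isLattice_packingDensity_ge_of_lt_one (K := K)
    (s := s) (by omega) hδ hδ1
  refine ⟨Λ, hΛ, le_trans ?_ hdens⟩
  have hN : 1 < (s + 1) * Module.finrank ℚ K := by
    have : 0 < Module.finrank ℚ K := Module.finrank_pos
    nlinarith
  have hζ : 0 < (riemannZeta (((s + 1) * Module.finrank ℚ K : ℕ) : ℂ)).re := by
    exact_mod_cast riemannZeta_re_pos_of_one_lt (x := (((s + 1) * Module.finrank ℚ K : ℕ) : ℝ))
      (by exact_mod_cast hN)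
  have hA : 0 ≤ 1 - Real.exp (-((s + 1 : ℕ) : ℝ)) := by
    rw [sub_nonneg, Real.exp_le_one_iff, neg_nonpos]
    exact Nat.cast_nonneg _
  gcongr
  exact min_le_left _ _
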